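/- **Conferencing Outer Bound.** *Setting.* Let $\mathcal X_1,\dots,\mathcal X_k$ and $\mathcal Y$ be non-empty standard Borel spaces and let $W(\cdot\mid x_{[k]})$ be a Markov kernel from $\mathcal X_{[k]}=\prod_{j}\mathcal X_j$ to $\mathcal Y$, regarded as a $k$-user memoryless multiple access channel (MAC) without feedback; this includes discrete MACs (finite or countably infinite alphabets, a probability mass function $p(y|x_{[k]})$) and continuous MACs ($\mathcal X_j=\mathcal Y=\mathbb R$, a jointly measurable conditional density $p(y|x_{[k]})$). Let $b_j:\mathcal X_j\to\mathbb R_{\ge 0}$ be measurable cost functions, $B_j\ge 0$ cost constraints, and $C_{ij}\ge 0$ ($i\ne j$) the capacity of a noiseless link from encoder $i$ to encoder $j$. Logarithms are to base $2$. *Codes.* An $L$-round $(C_{ij})$-conference code with blocklength $n$ and rates $R_1,\dots,R_k\ge 0$ has message sets $\mathcal W_j$ with $|\mathcal W_j|=\lceil 2^{nR_j}\rceil$ and finite non-empty alphabets $\mathcal V_{ij}^{(\ell)}$ ($i\neq j$, $1\le \ell\le L$) with $\sum_{\ell=1}^L\log|\mathcal V_{ij}^{(\ell)}|\le nC_{ij}$.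 In round $\ell$, encoder $j$ sends to each encoder $i\ne j$ a symbol of $\mathcal V_{ji}^{(\ell)}$ that is a function of its message $w_j$ and of all symbols it received in rounds $1,\dots,\ell-1$. After round $L$, encoder $j$ transmits a codeword $x_j^n=f_j(\cdot)\in\mathcal X_j^n$ that is a function of $w_j$ and of all symbols it received; every $x_j^n$ in the range of $f_j$ satisfies $\sum_{t=1}^n b_j(x_{jt})\le nB_j$. The decoder is a measurable map $g:\mathcal Y^n\to\prod_j\mathcal W_j$. The error probability $P_e^{(n)}$ is $\Pr\{g(Y^n)\ne W_{[k]}\}$ for $W_{[k]}$ uniform on $\prod_j\mathcal W_j$. Given a set $\Lambda\subseteq\mathbb N$ of allowed numbers of rounds ($\Lambda=\{L\}$ for $L$-round conferencing, $\Lambda=\mathbb N$ if the number of rounds is arbitrary and may vary with $n$), a rate vector is achievable if there is a sequence of such codes, one for each $n$ and each with a number of rounds in $\Lambda$, with $P_e^{(n)}\to 0$. The capacity region $\mathscr C_\Lambda$ is the closure of the set of achievable rate vectors. *Outer region.* Let $\mathscr R_{\mathrm{out}}$ be the set of all $(R_1,\dots,R_k)\in\mathbb R_{\ge 0}^k$ for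 which there are a finite set $\mathcal U_0$ and a distribution $p(u_0)\prod_{j=1}^k p(x_j|u_0)$ on $\mathcal U_0\times\mathcal X_{[k]}$ with $\mathbb E[b_j(X_j)]\le B_j$ for all $j$, such that, when $Y$ is the channel output for the input $X_{[k]}$, $$\sum_{j\in S}R_j\le I(X_S;Y\mid U_0,X_{S^c})+\sum_{j\in S}\sum_{i\ne j}C_{ji}\quad\text{for every non-empty } S\subseteq\{1,\dots,k\},$$ $$\sum_{j=1}^kR_j\le I(X_{[k]};Y).$$ *Claim.* For every $\Lambda$, $\mathscr C_\Lambda\subseteq\overline{\mathscr R_{\mathrm{out}}}$ (the closure). If in addition every input alphabet $\mathcal X_j$ is finite, then $\mathscr C_\Lambda\subseteq\mathscr R_{\mathrm{out}}$. -/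

import Mathlib

open MeasureTheory ProbabilityTheory Filter Topology
open scoped NNReal ENNReal

namespace ConferencingMAC

noncomputable section

/-! ### Mutual information (in bits) -/

section MutualInformation

variable {Ω α β γ : Type*} [MeasurableSpace Ω] [MeasurableSpace α] [MeasurableSpace β]
  [MeasurableSpace γ]

/-- Mutual information `I(A; B) = D(P_{AB} ‖ P_A × P_B)`, in bits. -/
def mutualInfo (A : Ω → α) (B : Ω → β) (μ : Measure Ω) : ℝ≥0∞ :=
  InformationTheory.klDiv (μ.map (fun ω => (A ω, B ω))) ((μ.map A).prod (μ.map B))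
    / ENNReal.ofReal (Real.log 2)

/-- Conditional mutual information `I(A; B | C) = D(P_{CAB} ‖ P_C ⊗ (P_{A|C} × P_{B|C}))`,
in bits. -/
def condMutualInfo [StandardBorelSpace α] [Nonempty α] [StandardBorelSpace β] [Nonempty β]
    (A : Ω → α) (B : Ω → β) (C : Ω → γ) (μ : Measure Ω) [IsFiniteMeasure μ] : ℝ≥0∞ :=
  InformationTheory.klDiv (μ.map (fun ω => (C ω, (A ω, B ω))))
      ((μ.map C) ⊗ₘ (condDistrib A C μ ×ₖ condDistrib B C μ))
    / ENNReal.ofReal (Real.log 2)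

end MutualInformation

universe u v

variable {k : ℕ} {X : Fin k → Type u} {Y : Type v}

/-! ### Codes for the multiple access channel with a conference -/

/-- A blocklength-`n` code with message sets of sizes `M 0, …, M (k-1)` and an `L`-round
`(C i j)`-conference, for cost functions `b j` and cost constraints `B j`. -/
structure Code [MeasurableSpace Y] (b : ∀ j, X j → ℝ≥0) (B : Fin k → ℝ≥0)
    (C : Fin k → Fin k → ℝ≥0) (M : Fin k → ℕ) (n L : ℕ) where
  /-- `size i j ℓ` is the number of symbols of the alphabet (taken to be `Fin (size i j ℓ)`)
  for what encoder `i` sends to encoder `j` in round `ℓ`; only the case `i ≠ j` is used. -/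
  size : Fin k → Fin k → Fin L → ℕ
  size_pos : ∀ i j ℓ, 0 < size i j ℓ
  size_le : ∀ i j, i ≠ j → ∑ ℓ, Real.logb 2 (size i j ℓ) ≤ n * C i j
  /-- What encoder `j` sends to encoder `i` in round `ℓ`, as a function of its message and of
  all the symbols received in the rounds before `ℓ`. -/
  send : ∀ (j : Fin k) (i : {i : Fin k // i ≠ j}) (ℓ : Fin L), Fin (M j) →
    (∀ (i' : {i' : Fin k // i' ≠ j}) (ℓ' : Fin L), ℓ' < ℓ → Fin (size i' j ℓ')) →
      Fin (size j i ℓ)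
  /-- The codeword of encoder `j`, as a function of its message and of everything received in
  the conference. -/
  encode : ∀ j : Fin k, Fin (M j) →
    (∀ (i : {i : Fin k // i ≠ j}) (ℓ : Fin L), Fin (size i j ℓ)) → Fin n → X j
  encode_cost : ∀ j w r, ∑ t, b j (encode j w r t) ≤ n * B j
  decode : (Fin n → Y) → ∀ j, Fin (M j)
  measurable_decode : Measurable decode

namespace Code

variable [MeasurableSpace Y] {b : ∀ j, X j → ℝ≥0} {B : Fin k → ℝ≥0} {C : Fin k → Fin k → ℝ≥0}
  {M : Fin k → ℕ} {n L : ℕ}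

/-- The symbol that encoder `j` sends to encoder `i` in round `ℓ` when the message vector
is `w`. -/
def symbol (c : Code (Y := Y) b B C M n L) (w : ∀ j, Fin (M j)) (ℓ : Fin L) (j : Fin k)
    (i : {i : Fin k // i ≠ j}) : Fin (c.size j i ℓ) :=
  c.send j i ℓ (w j) (fun i' ℓ' _ => c.symbol w ℓ' i' ⟨j, i'.2.symm⟩)
termination_by ℓ

/-- The codeword that encoder `j` transmits when the message vector is `w`. -/
def codeword (c : Code (Y := Y) b B C M n L) (w : ∀ j, Fin (M j)) (j : Fin k) : Fin n → X j :=
  c.encode j (w j) (fun i ℓ => c.symbol w ℓ i ⟨j, i.2.symm⟩)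

/-- Average error probability over the memoryless channel `W` (without feedback), the message
vector being uniformly distributed. -/
def errorProb [∀ j, MeasurableSpace (X j)] (c : Code (Y := Y) b B C M n L)
    (W : Kernel (∀ j, X j) Y) : ℝ :=
  (∑ w : (∀ j, Fin (M j)),
      (Measure.pi (fun t : Fin n => W (fun j => c.codeword w j t))).real {y | c.decode y ≠ w})
    / ∏ j, (M j : ℝ)

end Code

variable [∀ j, MeasurableSpace (X j)] [MeasurableSpace Y]

/-- `R` is achievable when the number of conferencing rounds at every blocklength has to lie
in `Λ`. Taking `Λ = {L}` fixes the number of rounds; `Λ = Set.univ` leaves it free. -/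
def IsAchievable (W : Kernel (∀ j, X j) Y) (b : ∀ j, X j → ℝ≥0) (B : Fin k → ℝ≥0)
    (C : Fin k → Fin k → ℝ≥0) (Λ : Set ℕ) (R : Fin k → ℝ) : Prop :=
  (∀ j, 0 ≤ R j) ∧
    ∃ L : ℕ → ℕ, (∀ n, L n ∈ Λ) ∧
      ∃ c : ∀ n : ℕ,
          Code (Y := Y) b B C (fun j => ⌈(2 : ℝ) ^ ((n : ℝ) * R j)⌉₊) n (L n),
        Tendsto (fun n => (c n).errorProb W) atTop (𝓝 0)

/-- The capacity region: the closure of the set of achievable rate vectors. -/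
def capacityRegion (W : Kernel (∀ j, X j) Y) (b : ∀ j, X j → ℝ≥0) (B : Fin k → ℝ≥0)
    (C : Fin k → Fin k → ℝ≥0) (Λ : Set ℕ) : Set (Fin k → ℝ) :=
  closure {R | IsAchievable W b B C Λ R}

/-! ### The outer bound -/

/-- A distribution `p(u₀) ∏ⱼ p(xⱼ | u₀)`, where `u₀` takes values in the finite alphabet
`Fin m`. -/
structure IndInput (X : Fin k → Type u) [∀ j, MeasurableSpace (X j)] (m : ℕ) where
  pU : ProbabilityMeasure (Fin m)
  pX : Fin m → ∀ j, ProbabilityMeasure (X j)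

namespace IndInput

variable {m : ℕ}

/-- The conditional distribution `∏ⱼ p(xⱼ | u₀)` of `X_[k]` given `U₀`. -/
def inputKernel (p : IndInput X m) : Kernel (Fin m) (∀ j, X j) where
  toFun u := Measure.pi (fun j => (p.pX u j : Measure (X j)))
  measurable' := measurable_from_top

instance (p : IndInput X m) : IsMarkovKernel p.inputKernel :=
  ⟨fun u => inferInstanceAs
    (IsProbabilityMeasure (Measure.pi (fun j => (p.pX u j : Measure (X j)))))⟩

/-- The joint distribution `p(u₀) ∏ⱼ p(xⱼ | u₀) p(y | x_[k])` of `((U₀, X_[k]), Y)`. -/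
def joint (p : IndInput X m) (W : Kernel (∀ j, X j) Y) : Measure ((Fin m × (∀ j, X j)) × Y) :=
  ((p.pU : Measure (Fin m)) ⊗ₘ p.inputKernel) ⊗ₘ Kernel.prodMkLeft (Fin m) W

instance (p : IndInput X m) (W : Kernel (∀ j, X j) Y) [IsMarkovKernel W] :
    IsProbabilityMeasure (p.joint W) := by
  unfold joint; infer_instance

/-- The cost constraints `E[b_j(X_j)] ≤ B_j`. -/
def SatisfiesCost (p : IndInput X m) (b : ∀ j, X j → ℝ≥0) (B : Fin k → ℝ≥0) : Prop :=
  ∀ j, ∫⁻ ω, (b j (ω.2 j) : ℝ≥0∞) ∂((p.pU : Measure (Fin m)) ⊗ₘ p.inputKernel) ≤ B j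

/-- `I(X_S; Y | U₀, X_{Sᶜ})`. -/
def condInfo [∀ j, StandardBorelSpace (X j)] [∀ j, Nonempty (X j)] [StandardBorelSpace Y]
    [Nonempty Y] (p : IndInput X m) (W : Kernel (∀ j, X j) Y) [IsMarkovKernel W]
    (S : Finset (Fin k)) : ℝ≥0∞ :=
  condMutualInfo (fun ω => S.restrict ω.1.2) (fun ω => ω.2)
    (fun ω => (ω.1.1, (Sᶜ : Finset (Fin k)).restrict ω.1.2)) (p.joint W)

/-- `I(X_[k]; Y)`. -/
def info (p : IndInput X m) (W : Kernel (∀ j, X j) Y) : ℝ≥0∞ :=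
  mutualInfo (fun ω => ω.1.2) (fun ω => ω.2) (p.joint W)

end IndInput

/-- The rate vectors that satisfy the two families of bounds for some distribution
`p(u₀) ∏ⱼ p(xⱼ | u₀)` (with a finite alphabet for `u₀`) that meets the cost constraints. -/
def outerRegion [∀ j, StandardBorelSpace (X j)] [∀ j, Nonempty (X j)] [StandardBorelSpace Y]
    [Nonempty Y] (W : Kernel (∀ j, X j) Y) [IsMarkovKernel W] (b : ∀ j, X j → ℝ≥0)
    (B : Fin k → ℝ≥0) (C : Fin k → Fin k → ℝ≥0) : Set (Fin k → ℝ) :=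
  {R | (∀ j, 0 ≤ R j) ∧
    ∃ (m : ℕ) (p : IndInput X m), p.SatisfiesCost b B ∧
      (∀ S : Finset (Fin k), S.Nonempty →
        ENNReal.ofReal (∑ j ∈ S, R j) ≤
          p.condInfo W S + ∑ j ∈ S, ∑ i ∈ Finset.univ.erase j, (C j i : ℝ≥0∞)) ∧
      ENNReal.ofReal (∑ j, R j) ≤ p.info W}

end

end ConferencingMAC

/-! The converse rests on the rectangle property of deterministic protocols: the message vectors
that produce a given conference transcript form a box (`Code.symbol_update`,
`BoxCode.piFinset_compatible`). For uniform messages, the codeword symbols at any one time are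
therefore conditionally independent given the transcript. With U₀ a uniform time together with the
transcript, this yields an input of the form p(u₀)∏ⱼp(xⱼ|u₀) (`BoxCode.pi_symbolLaw`), and the costs
carry over by averaging.

The rate bounds come from a change of measure instead of entropies, so general alphabets need no
extra care. For a set S, compare the true output law with the product over time of the laws of Y
given U₀ and X_{Sᶜ}. This reference depends on the messages only through a key, namely the messages
outside S and the symbols sent by S, because these determine the transcript. Under the reference,
the probabilities of correct decoding sum to at most the number of keys (`sum_real_le_card`), and
link capacities bound that number (`Code.logb_card_key_le`). A Donsker-Varadhan inequality
(`ofReal_le_sum_klDiv`) turns this into a lower bound on the divergence, whose average over the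
messages is at most n I(X_S;Y|U₀,X_{Sᶜ}) (`condInfo_eq`, `BoxCode.lintegral_inputMeasure`). The
constant reference given by the law of Y, with a single key, yields the sum-rate bound. The
vanishing losses are absorbed by scaling the rates down, which proves the inclusion in the closure.

For finite input alphabets the outer region is itself closed. Costs and I(X_[k];Y) depend only on
the law of X_[k], while the conditional informations are averages over U₀. The region is thus
described by the convex hull of the points (law, conditional informations) of product inputs. That
hull is compact, because mutual information is continuous on the simplex (`continuousOn_mutualSum`)
and convex hulls of compact sets are compact in finite dimension. -/

namespace ConferencingMAC

open InformationTheory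

set_option linter.unusedSectionVars false

universe u v

/-! ### Divergence: conditional form, tensorization, and a variational bound for events. -/

section KullbackLeibler

variable {α β : Type*} {mα : MeasurableSpace α} {mβ : MeasurableSpace β}

lemma measurable_klDiv [MeasurableSpace.CountableOrCountablyGenerated α β]
    (κ η : Kernel α β) [IsFiniteKernel κ] [IsFiniteKernel η] :
    Measurable fun a => klDiv (κ a) (η a) := by
  classical
  have h : (fun a => klDiv (κ a) (η a)) = fun a => if κ a ≪ η a then
      ∫⁻ y, ENNReal.ofReal (klFun (Kernel.rnDeriv κ η a y).toReal) ∂(η a) else ∞ := by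
    funext a
    rw [klDiv_eq_lintegral_klFun]
    refine if_congr Iff.rfl (lintegral_congr_ae ?_) rfl
    filter_upwards [Kernel.rnDeriv_eq_rnDeriv_measure (κ := κ) (η := η) (a := a)] with y hy
    rw [hy]
  rw [h]
  refine Measurable.ite (Kernel.measurableSet_absolutelyContinuous κ η) ?_ measurable_const
  refine Measurable.lintegral_kernel_prod_right ?_
  exact (measurable_klFun.comp (Kernel.measurable_rnDeriv κ η).ennreal_toReal).ennreal_ofReal

/-- Conditional Kullback-Leibler divergence as an integral. -/
lemma klDiv_compProd_right [MeasurableSpace.CountableOrCountablyGenerated α β]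
    (μ : Measure α) [IsFiniteMeasure μ] (κ η : Kernel α β) [IsFiniteKernel κ] [IsFiniteKernel η] :
    klDiv (μ ⊗ₘ κ) (μ ⊗ₘ η) = ∫⁻ a, klDiv (κ a) (η a) ∂μ := by
  by_cases hac : ∀ᵐ a ∂μ, κ a ≪ η a
  · have h_ac : μ ⊗ₘ κ ≪ μ ⊗ₘ η := Measure.absolutelyContinuous_compProd_right_iff.2 hac
    have hwd : μ ⊗ₘ κ = (μ ⊗ₘ η).withDensity fun p => Kernel.rnDeriv κ η p.1 p.2 := by
      rw [← Measure.compProd_withDensity (f := Kernel.rnDeriv κ η)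
        (Kernel.measurable_rnDeriv κ η)]
      refine Measure.compProd_congr ?_
      filter_upwards [hac] with a ha using (Kernel.withDensity_rnDeriv_eq ha).symm
    have hrn : (μ ⊗ₘ κ).rnDeriv (μ ⊗ₘ η) =ᵐ[μ ⊗ₘ η] fun p => Kernel.rnDeriv κ η p.1 p.2 := by
      conv_lhs => rw [hwd]
      exact Measure.rnDeriv_withDensity _ (Kernel.measurable_rnDeriv κ η)
    rw [klDiv_eq_lintegral_klFun_of_ac h_ac]
    calc _ = ∫⁻ p, ENNReal.ofReal (klFun (Kernel.rnDeriv κ η p.1 p.2).toReal) ∂(μ ⊗ₘ η) := by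
          refine lintegral_congr_ae ?_
          filter_upwards [hrn] with p hp
          rw [hp]
      _ = ∫⁻ a, ∫⁻ y, ENNReal.ofReal (klFun (Kernel.rnDeriv κ η a y).toReal) ∂(η a) ∂μ :=
          Measure.lintegral_compProd
            (measurable_klFun.comp (Kernel.measurable_rnDeriv κ η).ennreal_toReal).ennreal_ofReal
      _ = _ := by
          refine lintegral_congr_ae ?_
          filter_upwards [hac] with a ha
          rw [klDiv_eq_lintegral_klFun_of_ac ha]
          refine lintegral_congr_ae ?_
          filter_upwards [Kernel.rnDeriv_eq_rnDeriv_measure (κ := κ) (η := η) (a := a)] with y hy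
          rw [hy]
  · rw [klDiv_of_not_ac fun h => hac (Measure.absolutelyContinuous_compProd_right_iff.1 h)]
    symm
    by_contra hne
    refine hac ?_
    filter_upwards [ae_lt_top (measurable_klDiv κ η) hne] with a ha
    exact (klDiv_ne_top_iff.1 ha.ne).1

lemma klDiv_map_equiv (e : α ≃ᵐ β) (μ ν : Measure α) [IsFiniteMeasure μ] [IsFiniteMeasure ν] :
    klDiv (μ.map e) (ν.map e) = klDiv μ ν := by
  refine le_antisymm (klDiv_map_le μ ν e.measurable) ?_
  have h := klDiv_map_le (μ.map e) (ν.map e) e.symm.measurable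
  simpa [Measure.map_map e.symm.measurable e.measurable] using h

/-- Data processing, applied to `f` and then to its left inverse. -/
lemma klDiv_map_leftInverse {f : α → β} {g : β → α} (hf : Measurable f) (hg : Measurable g)
    (hgf : ∀ a, g (f a) = a) (μ ν : Measure α) [IsFiniteMeasure μ] [IsFiniteMeasure ν] :
    klDiv (μ.map f) (ν.map f) = klDiv μ ν := by
  refine le_antisymm (klDiv_map_le μ ν hf) ?_
  have h := klDiv_map_le (μ.map f) (ν.map f) hg
  have hid : g ∘ f = id := funext hgf
  simpa [Measure.map_map hg hf, hid] using h

lemma klDiv_prod (μ μ' : Measure α) (ν ν' : Measure β) [IsProbabilityMeasure μ]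
    [IsProbabilityMeasure μ'] [IsProbabilityMeasure ν] [IsProbabilityMeasure ν'] :
    klDiv (μ.prod ν) (μ'.prod ν') = klDiv μ μ' + klDiv ν ν' := by
  have h := klDiv_compProd_eq_add μ μ' (Kernel.const α ν) (Kernel.const α ν')
  simp only [Measure.compProd_const] at h
  rw [h]
  congr 1
  -- The chain rule leaves `μ` as a common first factor; swapping the factors lets it be cancelled.
  have hs : ∀ ρ : Measure β, IsProbabilityMeasure ρ →
      μ.prod ρ = (ρ ⊗ₘ Kernel.const β μ).map MeasurableEquiv.prodComm := by
    intro ρ _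
    rw [Measure.compProd_const]
    exact (Measure.prod_swap).symm
  rw [hs ν inferInstance, hs ν' inferInstance, klDiv_map_equiv, klDiv_compProd_left]

lemma klDiv_pi_le {n : ℕ} (P Q : Fin n → Measure α) [∀ t, IsProbabilityMeasure (P t)]
    [∀ t, IsProbabilityMeasure (Q t)] :
    klDiv (Measure.pi P) (Measure.pi Q) ≤ ∑ t, klDiv (P t) (Q t) := by
  induction n with
  | zero =>
    have : Measure.pi P = Measure.pi Q := by
      rw [Measure.pi_of_empty P, Measure.pi_of_empty Q]
    simp [this]
  | succ n ih =>
    let e := (MeasurableEquiv.piFinSuccAbove (fun _ : Fin (n + 1) => α) 0)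
    have h1 : ∀ R : Fin (n + 1) → Measure α, (∀ t, IsProbabilityMeasure (R t)) →
        Measure.pi R = ((R 0).prod (Measure.pi fun t : Fin n => R t.succ)).map e.symm := by
      intro R _
      exact ((measurePreserving_piFinSuccAbove R 0).symm _).map_eq.symm
    rw [h1 P inferInstance, h1 Q inferInstance, klDiv_map_equiv, klDiv_prod, Fin.sum_univ_succ]
    gcongr
    exact ih _ _

/-- The Fenchel-Young inequality: `exp s - 1` is the convex conjugate of `klFun`. -/
lemma mul_sub_exp_add_one_le_klFun {x : ℝ} (hx : 0 ≤ x) (s : ℝ) :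
    x * s - Real.exp s + 1 ≤ klFun x := by
  rw [klFun_apply]
  rcases hx.eq_or_lt with rfl | hx
  · simp [Real.exp_nonneg]
  · have h := Real.add_one_le_exp (s - Real.log x)
    rw [Real.exp_sub, Real.exp_log hx, le_div_iff₀ hx] at h
    linarith

/-- A Donsker-Varadhan type bound for the indicator of an event. -/
lemma ofReal_event_le_klDiv (P Q : Measure α) [IsProbabilityMeasure P] [IsProbabilityMeasure Q]
    {A : Set α} (hA : MeasurableSet A) (s : ℝ) :
    ENNReal.ofReal (s * P.real A - Real.log 2 + 1 - (1 + (Real.exp s - 1) * Q.real A) / 2)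
      ≤ klDiv P Q := by
  by_cases hfin : klDiv P Q = ∞
  · simp [hfin]
  obtain ⟨hac, hint⟩ := klDiv_ne_top_iff.1 hfin
  refine ENNReal.ofReal_le_of_le_toReal ?_
  rw [toReal_klDiv_eq_integral_klFun hac]
  set r : α → ℝ := fun x => (P.rnDeriv Q x).toReal with hr
  have hri : Integrable r Q := Measure.integrable_toReal_rnDeriv
  have hone : Integrable (A.indicator fun _ => (1 : ℝ)) Q :=
    (integrable_const _).indicator hA
  -- Fenchel-Young with slope `s - log 2` on `A` and `-log 2` off it. The shift suits the case where
  -- `exp s * Q A` is about 1. Unlike the optimal logarithmic form, the result is linear in `Q A`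
  -- and can be summed over messages.
  have hpt : ∀ x, s * A.indicator r x - Real.log 2 * r x + 1
      - (1 + (Real.exp s - 1) * A.indicator (fun _ => (1 : ℝ)) x) / 2 ≤ klFun (r x) := by
    intro x
    by_cases hx : x ∈ A
    · have h := mul_sub_exp_add_one_le_klFun (x := r x) ENNReal.toReal_nonneg (s - Real.log 2)
      rw [Real.exp_sub, Real.exp_log two_pos] at h
      simp only [Set.indicator_of_mem hx]
      linarith
    · have h := mul_sub_exp_add_one_le_klFun (x := r x) ENNReal.toReal_nonneg (- Real.log 2)
      rw [Real.exp_neg, Real.exp_log two_pos] at h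
      simp only [Set.indicator_of_notMem hx]
      linarith
  calc _ = ∫ x, (s * A.indicator r x - Real.log 2 * r x + 1
      - (1 + (Real.exp s - 1) * A.indicator (fun _ => (1 : ℝ)) x) / 2) ∂Q := by
        have i1 : Integrable (fun x => s * A.indicator r x) Q := (hri.indicator hA).const_mul s
        have i2 : Integrable (fun x => Real.log 2 * r x) Q := hri.const_mul (Real.log 2)
        have i3 : Integrable (fun x => (Real.exp s - 1) * A.indicator (fun _ => (1 : ℝ)) x) Q :=
          hone.const_mul (Real.exp s - 1)
        have i4 : Integrable (fun x => s * A.indicator r x - Real.log 2 * r x) Q := i1.sub i2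
        have i5 : Integrable (fun x => s * A.indicator r x - Real.log 2 * r x + 1) Q :=
          i4.add (integrable_const _)
        have i6 : Integrable
            (fun x => (1 + (Real.exp s - 1) * A.indicator (fun _ => (1 : ℝ)) x) / 2) Q :=
          ((integrable_const _).add i3).div_const _
        rw [integral_sub i5 i6, integral_add i4 (integrable_const _), integral_sub i1 i2,
          integral_div, integral_add (integrable_const _) i3, integral_const_mul,
          integral_const_mul, integral_const_mul, integral_indicator hA, integral_indicator hA,
          hr, Measure.setIntegral_toReal_rnDeriv hac, Measure.integral_toReal_rnDeriv hac]
        simp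
    _ ≤ _ := by
        refine integral_mono ?_ ?_ hpt
        · exact (((hri.indicator hA).const_mul s).sub (hri.const_mul _)).add (integrable_const _)
            |>.sub (((integrable_const _).add (hone.const_mul _)).div_const _)
        · exact (integrable_klFun_rnDeriv_iff hac).2 hint

end KullbackLeibler

/-! ### A Fano-type converse by change of measure. -/

section Fano

variable {Ω Z : Type*} [Fintype Ω] [MeasurableSpace Z]

/-- A converse bound: if a decoder `g` guesses `w` with the family `Q` only rarely, then the
family `P` under which it guesses well has large divergence from `Q`. -/
lemma ofReal_le_sum_klDiv (P Q : Ω → Measure Z) [∀ w, IsProbabilityMeasure (P w)]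
    [∀ w, IsProbabilityMeasure (Q w)] (A : Ω → Set Z) (hA : ∀ w, MeasurableSet (A w))
    {K : ℝ} (hK : 0 < K) [Nonempty Ω] (hQ : ∑ w, (Q w).real (A w) ≤ K) :
    ENNReal.ofReal (Real.log ((Fintype.card Ω : ℝ) / K) * ∑ w, (P w).real (A w)
        - (Fintype.card Ω : ℝ) * Real.log 2) ≤ ∑ w, klDiv (P w) (Q w) := by
  set N : ℝ := (Fintype.card Ω : ℝ) with hN
  have hNpos : 0 < N := by rw [hN]; exact_mod_cast Fintype.card_pos
  -- With this `s`, `exp s * ∑ Q w (A w) ≤ N`, so the terms in `Q` are paid for by the constants and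
  -- only `log 2` per message is lost.
  set s := Real.log (N / K) with hs
  have hes : Real.exp s = N / K := Real.exp_log (by positivity)
  calc _ ≤ ENNReal.ofReal (∑ w, (s * (P w).real (A w) - Real.log 2 + 1
        - (1 + (Real.exp s - 1) * (Q w).real (A w)) / 2)) := by
        refine ENNReal.ofReal_le_ofReal ?_
        simp only [Finset.sum_sub_distrib, Finset.sum_add_distrib, ← Finset.mul_sum,
          ← Finset.sum_div, Finset.sum_const, Finset.card_univ, nsmul_eq_mul, ← hN, hes]
        have h0 : 0 ≤ ∑ w, (Q w).real (A w) := Finset.sum_nonneg fun _ _ => measureReal_nonneg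
        have h1 : N / K * ∑ w, (Q w).real (A w) ≤ N := by
          calc _ ≤ N / K * K := by gcongr
            _ = N := by field_simp
        linarith
    _ ≤ ∑ w, ENNReal.ofReal (s * (P w).real (A w) - Real.log 2 + 1
        - (1 + (Real.exp s - 1) * (Q w).real (A w)) / 2) := by
        classical
        refine Finset.induction_on (Finset.univ : Finset Ω) (by simp) ?_
        intro a t ha ih
        rw [Finset.sum_insert ha, Finset.sum_insert ha]
        exact ENNReal.ofReal_add_le.trans (by gcongr)
    _ ≤ _ := Finset.sum_le_sum fun w _ => ofReal_event_le_klDiv (P w) (Q w) (hA w) s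

/-- If `Q w` depends on `w` only through `key w`, a decoder guesses `w` with total probability at
most the number of keys. -/
lemma sum_real_le_card {T : Type*} [Fintype T] (Q : Ω → Measure Z)
    [∀ w, IsProbabilityMeasure (Q w)] (key : Ω → T) (hkey : ∀ w w', key w = key w' → Q w = Q w')
    (A : Ω → Set Z) (hA : ∀ w, MeasurableSet (A w))
    (hdisj : Pairwise fun w w' => Disjoint (A w) (A w')) :
    ∑ w, (Q w).real (A w) ≤ Fintype.card T := by
  classical
  rw [← Finset.sum_fiberwise_of_maps_to (g := key) (t := Finset.univ)
      (fun _ _ => Finset.mem_univ _),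
    ← nsmul_one (Fintype.card T), ← Finset.card_univ, ← Finset.sum_const]
  refine Finset.sum_le_sum fun τ _ => ?_
  by_cases hne : ∃ w₀, key w₀ = τ
  · obtain ⟨w₀, rfl⟩ := hne
    calc _ = ∑ w with key w = key w₀, (Q w₀).real (A w) := by
          refine Finset.sum_congr rfl fun w hw => ?_
          rw [hkey w w₀ (Finset.mem_filter.1 hw).2]
      _ = (Q w₀).real (⋃ w ∈ Finset.univ.filter fun w => key w = key w₀, A w) := by
          rw [measureReal_biUnion_finset (fun w _ w' _ h => hdisj h) fun w _ => hA w]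
      _ ≤ 1 := measureReal_le_one
  · rw [Finset.filter_false_of_mem fun w _ h => hne ⟨w, h⟩]
    simp

end Fano

noncomputable section

/-! ### Resampling independent coordinates, and informations as average divergences. -/

section Resampling

variable {ι : Type*} [Fintype ι] [DecidableEq ι] {X : ι → Type*} [∀ j, MeasurableSpace (X j)]

lemma measurable_piecewise (S : Finset ι) :
    Measurable fun z : (∀ j, X j) × (∀ j, X j) => S.piecewise z.1 z.2 := by
  refine measurable_pi_lambda _ fun j => ?_
  by_cases hj : j ∈ S
  · simp only [hj, Finset.piecewise_eq_of_mem]; fun_prop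
  · simp only [hj, not_false_eq_true, Finset.piecewise_eq_of_notMem]; fun_prop

lemma map_piecewise_pi (μ : ∀ j, Measure (X j)) [∀ j, IsProbabilityMeasure (μ j)]
    (S : Finset ι) :
    ((Measure.pi μ).prod (Measure.pi μ)).map (fun z => S.piecewise z.1 z.2) = Measure.pi μ := by
  refine (Measure.pi_eq fun s hs => ?_).symm
  rw [Measure.map_apply (measurable_piecewise S) (MeasurableSet.univ_pi hs)]
  have hpre : (fun z : (∀ j, X j) × (∀ j, X j) => S.piecewise z.1 z.2) ⁻¹' Set.univ.pi s =
      (Set.univ.pi fun j => if j ∈ S then s j else Set.univ) ×ˢ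
        (Set.univ.pi fun j => if j ∈ S then Set.univ else s j) := by
    ext z
    simp only [Set.mem_preimage, Set.mem_univ_pi, Set.mem_prod, ← forall_and]
    refine forall_congr' fun j => ?_
    by_cases hj : j ∈ S <;> simp [hj]
  rw [hpre, Measure.prod_prod, Measure.pi_pi, Measure.pi_pi, ← Finset.prod_mul_distrib]
  refine Finset.prod_congr rfl fun j _ => ?_
  by_cases hj : j ∈ S <;> simp [hj]

/-- Resampling the coordinates in `S` of a vector with independent coordinates. -/
lemma lintegral_lintegral_piecewise (μ : ∀ j, Measure (X j)) [∀ j, IsProbabilityMeasure (μ j)]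
    (S : Finset ι) {f : (∀ j, X j) → ℝ≥0∞} (hf : Measurable f) :
    ∫⁻ x, ∫⁻ x', f (S.piecewise x' x) ∂Measure.pi μ ∂Measure.pi μ = ∫⁻ x, f x ∂Measure.pi μ := by
  have hm : Measurable fun z : (∀ j, X j) × (∀ j, X j) => f (S.piecewise z.1 z.2) :=
    hf.comp (measurable_piecewise S)
  conv_rhs => rw [← map_piecewise_pi μ S]
  rw [lintegral_map hf (measurable_piecewise S), lintegral_prod_symm' _ hm]

end Resampling

variable {k m : ℕ} {X : Fin k → Type u} {Y : Type v} [∀ j, MeasurableSpace (X j)]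
  [MeasurableSpace Y]

/-- Takes the coordinates in `S` from the first vector and the others from the second one. -/
def glue (S : Finset (Fin k)) (z : (∀ j, X j) × (∀ j : (Sᶜ : Finset (Fin k)), X j)) (j : Fin k) :
    X j :=
  if h : j ∈ S then z.1 j else z.2 ⟨j, Finset.mem_compl.2 h⟩

lemma measurable_glue (S : Finset (Fin k)) : Measurable (glue (X := X) S) := by
  refine measurable_pi_lambda _ fun j => ?_
  by_cases hj : j ∈ S
  · simp only [glue, hj, dite_true]; fun_prop
  · simp only [glue, hj, dite_false]; fun_prop

lemma glue_restrict (S : Finset (Fin k)) (x' x : ∀ j, X j) :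
    glue S (x', (Sᶜ : Finset (Fin k)).restrict x) = S.piecewise x' x := by
  funext j
  by_cases hj : j ∈ S <;> simp [glue, hj]

namespace IndInput

/-- The joint distribution of `(U₀, X_[k])`. -/
def inputMeasure (p : IndInput X m) : Measure (Fin m × ∀ j, X j) :=
  (p.pU : Measure (Fin m)) ⊗ₘ p.inputKernel

instance (p : IndInput X m) : IsProbabilityMeasure p.inputMeasure := by
  unfold inputMeasure; infer_instance

/-- The conditional distribution of the channel output given `U₀` and `X_{Sᶜ}`. -/
def condOutput (p : IndInput X m) (W : Kernel (∀ j, X j) Y) (S : Finset (Fin k)) :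
    Kernel (Fin m × ∀ j : (Sᶜ : Finset (Fin k)), X j) Y :=
  W ∘ₖ ((p.inputKernel.comap Prod.fst measurable_fst) ×ₖ
    Kernel.deterministic Prod.snd measurable_snd).map (glue S)

/-- `condOutput`, as a function of `U₀` and the whole input vector. -/
def outKernel (p : IndInput X m) (W : Kernel (∀ j, X j) Y) (S : Finset (Fin k)) :
    Kernel (Fin m × ∀ j, X j) Y :=
  (p.condOutput W S).comap (fun z => (z.1, (Sᶜ : Finset (Fin k)).restrict z.2))
    (measurable_fst.prodMk ((Finset.measurable_restrict _).comp measurable_snd))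

variable (p : IndInput X m) (W : Kernel (∀ j, X j) Y) [IsMarkovKernel W] (S : Finset (Fin k))

instance : IsMarkovKernel (p.condOutput W S) := by
  have : IsMarkovKernel (((p.inputKernel.comap Prod.fst measurable_fst) ×ₖ
    Kernel.deterministic Prod.snd measurable_snd).map (glue (X := X) S)) :=
    Kernel.IsMarkovKernel.map _ (measurable_glue S)
  unfold condOutput; infer_instance

instance : IsMarkovKernel (p.outKernel W S) := by
  unfold outKernel; infer_instance

/-- The reference output law: redraw the inputs in `S` given `u`, keep the others, and use the
channel. -/
lemma outKernel_apply (u : Fin m) (x : ∀ j, X j) :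
    p.outKernel W S (u, x) = W ∘ₘ ((p.inputKernel u).map fun x' => S.piecewise x' x) := by
  rw [outKernel, Kernel.comap_apply, condOutput, Kernel.comp_apply,
    Kernel.map_apply _ (measurable_glue S), Kernel.prod_apply, Kernel.comap_apply,
    Kernel.deterministic_apply, Measure.prod_dirac,
    Measure.map_map (measurable_glue S) (by fun_prop)]
  simp only [Function.comp_def, glue_restrict]

lemma lintegral_outKernel (u : Fin m) (x : ∀ j, X j) {f : Y → ℝ≥0∞} (hf : Measurable f) :
    ∫⁻ y, f y ∂p.outKernel W S (u, x) =
      ∫⁻ x', ∫⁻ y, f y ∂W (S.piecewise x' x) ∂p.inputKernel u := by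
  have hpw : Measurable fun x' : ∀ j, X j => S.piecewise x' x :=
    (measurable_piecewise S).comp (measurable_id.prodMk measurable_const)
  rw [outKernel_apply, Measure.lintegral_bind W.aemeasurable hf.aemeasurable,
    lintegral_map hf.lintegral_kernel hpw]

lemma lintegral_inputMeasure {f : Fin m × (∀ j, X j) → ℝ≥0∞} (hf : Measurable f) :
    ∫⁻ z, f z ∂p.inputMeasure = ∫⁻ u, ∫⁻ x, f (u, x) ∂p.inputKernel u ∂(p.pU : Measure (Fin m)) :=
  Measure.lintegral_compProd hf

/-- Given U₀ the inputs are independent, so a fresh conditional copy of X_S leaves the joint law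
unchanged. This identifies the conditional laws in `condInfo_eq`. -/
lemma lintegral_inputMeasure_resample {f : Fin m × (∀ j, X j) → ℝ≥0∞} (hf : Measurable f) :
    ∫⁻ z, ∫⁻ x', f (z.1, S.piecewise x' z.2) ∂p.inputKernel z.1 ∂p.inputMeasure =
      ∫⁻ z, f z ∂p.inputMeasure := by
  have hm : Measurable fun z : (Fin m × ∀ j, X j) × (∀ j, X j) =>
      f (z.1.1, S.piecewise z.2 z.1.2) :=
    hf.comp ((measurable_fst.comp measurable_fst).prodMk ((measurable_piecewise S).comp
      (measurable_snd.prodMk (measurable_snd.comp measurable_fst))))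
  have hm' : Measurable fun z : Fin m × ∀ j, X j =>
      ∫⁻ x', f (z.1, S.piecewise x' z.2) ∂p.inputKernel z.1 :=
    Measurable.lintegral_kernel_prod_right' (κ := p.inputKernel.comap Prod.fst measurable_fst) hm
  rw [lintegral_inputMeasure p hm', lintegral_inputMeasure p hf]
  refine lintegral_congr fun u => ?_
  exact lintegral_lintegral_piecewise (fun j => (p.pX u j : Measure (X j))) S
    (hf.comp measurable_prodMk_left)

lemma joint_eq : p.joint W = p.inputMeasure ⊗ₘ Kernel.prodMkLeft (Fin m) W := rfl

lemma lintegral_joint {f : (Fin m × (∀ j, X j)) × Y → ℝ≥0∞} (hf : Measurable f) :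
    ∫⁻ z, f z ∂p.joint W = ∫⁻ z, ∫⁻ y, f (z, y) ∂W z.2 ∂p.inputMeasure := by
  rw [joint_eq, Measure.lintegral_compProd hf]
  rfl

lemma lintegral_map_joint {γ : Type*} [MeasurableSpace γ] {g : (Fin m × (∀ j, X j)) × Y → γ}
    (hg : Measurable g) {f : γ → ℝ≥0∞} (hf : Measurable f) :
    ∫⁻ c, f c ∂(p.joint W).map g = ∫⁻ z, ∫⁻ y, f (g (z, y)) ∂W z.2 ∂p.inputMeasure := by
  rw [lintegral_map hf hg]
  exact lintegral_joint p W (hf.comp hg)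

section Formulas

variable [∀ j, StandardBorelSpace (X j)] [∀ j, Nonempty (X j)] [StandardBorelSpace Y] [Nonempty Y]

lemma measurable_klDiv_outKernel :
    Measurable fun z : Fin m × ∀ j, X j => klDiv (W z.2) (p.outKernel W S z) :=
  measurable_klDiv (Kernel.prodMkLeft (Fin m) W) (p.outKernel W S)

/-- `I(X_S; Y | U₀, X_{Sᶜ})` as an average divergence. -/
lemma condInfo_eq : p.condInfo W S =
    (∫⁻ z, klDiv (W z.2) (p.outKernel W S z) ∂p.inputMeasure) / ENNReal.ofReal (Real.log 2) := by
  unfold condInfo condMutualInfo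
  congr 1
  set A : (Fin m × ∀ j, X j) × Y → ∀ j : S, X j := fun ω => S.restrict ω.1.2 with hA
  set B : (Fin m × ∀ j, X j) × Y → Y := fun ω => ω.2 with hB
  set C : (Fin m × ∀ j, X j) × Y → Fin m × ∀ j : (Sᶜ : Finset (Fin k)), X j :=
    fun ω => (ω.1.1, (Sᶜ : Finset (Fin k)).restrict ω.1.2) with hC
  have hAm : Measurable A :=
    (Finset.measurable_restrict _).comp (measurable_snd.comp measurable_fst)
  have hBm : Measurable B := measurable_snd
  have hCm : Measurable C := (measurable_fst.comp measurable_fst).prodMk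
    ((Finset.measurable_restrict _).comp (measurable_snd.comp measurable_fst))
  let κA : Kernel (Fin m × ∀ j : (Sᶜ : Finset (Fin k)), X j) (∀ j : S, X j) :=
    (p.inputKernel.comap Prod.fst measurable_fst).map S.restrict
  have : IsMarkovKernel κA := Kernel.IsMarkovKernel.map _ (Finset.measurable_restrict S)
  have hκA : ∀ c {f : (∀ j : S, X j) → ℝ≥0∞}, Measurable f →
      ∫⁻ a, f a ∂κA c = ∫⁻ x', f (S.restrict x') ∂p.inputKernel c.1 := by
    intro c f hf
    rw [Kernel.map_apply _ (Finset.measurable_restrict S), Kernel.comap_apply,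
      lintegral_map hf (Finset.measurable_restrict S)]
  have hrS : ∀ x' x : ∀ j, X j, S.restrict (S.piecewise x' x) = S.restrict x' := by
    intro x' x
    funext j
    simp
  have hrSc : ∀ x' x : ∀ j, X j, (Sᶜ : Finset (Fin k)).restrict (S.piecewise x' x) =
      (Sᶜ : Finset (Fin k)).restrict x := by
    intro x' x
    funext j
    simp [Finset.mem_compl.1 j.2]
  have hlC : ∀ {f : Fin m × (∀ j : (Sᶜ : Finset (Fin k)), X j) → ℝ≥0∞}, Measurable f →
      ∫⁻ c, f c ∂(p.joint W).map C =
        ∫⁻ z, f (z.1, (Sᶜ : Finset (Fin k)).restrict z.2) ∂p.inputMeasure := by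
    intro f hf
    rw [lintegral_map_joint p W hCm hf]
    simp [hC]
  -- By conditional independence, the law of X_S given (U₀, X_{Sᶜ}) depends on U₀ alone.
  have hA' : condDistrib A C (p.joint W) =ᵐ[(p.joint W).map C] κA := by
    refine condDistrib_ae_eq_of_measure_eq_compProd C hAm.aemeasurable ?_
    refine Measure.ext_of_lintegral _ fun f hf => ?_
    rw [Measure.lintegral_compProd hf, hlC hf.lintegral_kernel_prod_right',
      lintegral_map_joint p W (hCm.prodMk hAm) hf]
    simp only [hA, hC, lintegral_const, measure_univ, mul_one]
    have hg : Measurable fun z : Fin m × (∀ j, X j) =>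
        f ((z.1, (Sᶜ : Finset (Fin k)).restrict z.2), S.restrict z.2) := hf.comp (by fun_prop)
    rw [← lintegral_inputMeasure_resample p S hg]
    refine lintegral_congr fun z => ?_
    have hf1 : Measurable fun a : ∀ j : S, X j =>
        f ((z.1, (Sᶜ : Finset (Fin k)).restrict z.2), a) := hf.comp measurable_prodMk_left
    rw [hκA _ hf1]
    simp only [hrS, hrSc]
  have hB' : condDistrib B C (p.joint W) =ᵐ[(p.joint W).map C] p.condOutput W S := by
    refine condDistrib_ae_eq_of_measure_eq_compProd C hBm.aemeasurable ?_
    refine Measure.ext_of_lintegral _ fun f hf => ?_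
    rw [Measure.lintegral_compProd hf, hlC hf.lintegral_kernel_prod_right',
      lintegral_map_joint p W (hCm.prodMk hBm) hf]
    have hg : Measurable fun z : Fin m × (∀ j, X j) =>
        ∫⁻ y, f ((z.1, (Sᶜ : Finset (Fin k)).restrict z.2), y) ∂W z.2 :=
      Measurable.lintegral_kernel_prod_right' (κ := Kernel.prodMkLeft (Fin m) W)
        (f := fun q => f ((q.1.1, (Sᶜ : Finset (Fin k)).restrict q.1.2), q.2))
        (hf.comp (by fun_prop))
    simp only [hB, hC]
    rw [← lintegral_inputMeasure_resample p S hg]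
    refine lintegral_congr fun z => ?_
    simp only [hrSc]
    exact (lintegral_outKernel p W S z.1 z.2 (f := fun y =>
      f ((z.1, (Sᶜ : Finset (Fin k)).restrict z.2), y)) (hf.comp measurable_prodMk_left)).symm
  have hprod : (p.joint W).map C ⊗ₘ (condDistrib A C (p.joint W) ×ₖ condDistrib B C (p.joint W)) =
      (p.joint W).map C ⊗ₘ (κA ×ₖ p.condOutput W S) := by
    refine Measure.compProd_congr ?_
    filter_upwards [hA', hB'] with c h1 h2
    rw [Kernel.prod_apply, Kernel.prod_apply, h1, h2]
  set φ : (Fin m × ∀ j, X j) × Y →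
      (Fin m × ∀ j : (Sᶜ : Finset (Fin k)), X j) × ((∀ j : S, X j) × Y) :=
    fun ω => (C ω, (A ω, B ω)) with hφ
  have hφm : Measurable φ := hCm.prodMk (hAm.prodMk hBm)
  -- The reference in the definition of the information is a rearrangement of the law under which Y
  -- is drawn from `outKernel`.
  have href : (p.joint W).map C ⊗ₘ (κA ×ₖ p.condOutput W S) =
      (p.inputMeasure ⊗ₘ p.outKernel W S).map φ := by
    refine Measure.ext_of_lintegral _ fun f hf => ?_
    have hfφ : Measurable fun ω => f (φ ω) := hf.comp hφm
    rw [Measure.lintegral_compProd hf, hlC hf.lintegral_kernel_prod_right', lintegral_map hf hφm,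
      Measure.lintegral_compProd hfφ]
    have hg : Measurable fun z : Fin m × (∀ j, X j) => ∫⁻ y, f (φ (z, y)) ∂p.outKernel W S z :=
      Measurable.lintegral_kernel_prod_right' (hf.comp hφm)
    rw [← lintegral_inputMeasure_resample p S hg]
    refine lintegral_congr fun z => ?_
    have hf1 : Measurable fun q : (∀ j : S, X j) × Y =>
        f ((z.1, (Sᶜ : Finset (Fin k)).restrict z.2), q) := hf.comp measurable_prodMk_left
    rw [Kernel.prod_apply, lintegral_prod _ hf1.aemeasurable, hκA _ hf1.lintegral_prod_right']
    refine lintegral_congr fun x' => ?_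
    simp only [hφ, hA, hB, hC, hrS, hrSc, outKernel, Kernel.comap_apply]
  rw [hprod, href, joint_eq]
  -- `ψ` reassembles the input vector, so the rearrangement `φ` costs no divergence.
  let ψ : (Fin m × ∀ j : (Sᶜ : Finset (Fin k)), X j) × ((∀ j : S, X j) × Y) →
      (Fin m × ∀ j, X j) × Y := fun q =>
    ((q.1.1, fun j => if h : j ∈ S then q.2.1 ⟨j, h⟩ else q.1.2 ⟨j, Finset.mem_compl.2 h⟩), q.2.2)
  have hψm : Measurable ψ := by
    refine Measurable.prodMk (Measurable.prodMk (by fun_prop) ?_) (by fun_prop)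
    refine measurable_pi_lambda _ fun j => ?_
    by_cases hj : j ∈ S
    · simp only [hj, dite_true]; fun_prop
    · simp only [hj, dite_false]; fun_prop
  have hψφ : ∀ ω, ψ (φ ω) = ω := by
    rintro ⟨⟨u, x⟩, y⟩
    simp only [ψ, hφ, hA, hB, hC, Prod.mk.injEq, and_true, true_and]
    funext j
    by_cases hj : j ∈ S <;> simp [hj]
  rw [klDiv_map_leftInverse hφm hψm hψφ, klDiv_compProd_right]
  rfl

/-- The distribution of `X_[k]`. -/
def inputLaw (p : IndInput X m) : Measure (∀ j, X j) := p.inputMeasure.map Prod.snd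

instance : IsProbabilityMeasure p.inputLaw :=
  Measure.isProbabilityMeasure_map measurable_snd.aemeasurable

/-- `I(X_[k]; Y)` as an average divergence. -/
lemma info_eq : p.info W =
    (∫⁻ z, klDiv (W z.2) (W ∘ₘ p.inputLaw) ∂p.inputMeasure) / ENNReal.ofReal (Real.log 2) := by
  unfold info mutualInfo
  congr 1
  have h1 : (p.joint W).map (fun ω => (ω.1.2, ω.2)) = p.inputLaw ⊗ₘ W := by
    refine Measure.ext_of_lintegral _ fun f hf => ?_
    rw [lintegral_map_joint p W (by fun_prop) hf,
      Measure.lintegral_compProd hf, inputLaw,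
      lintegral_map hf.lintegral_kernel_prod_right' measurable_snd]
  have h2 : (p.joint W).map (fun ω => ω.1.2) = p.inputLaw := by
    have h := congrArg Measure.fst h1
    rw [Measure.fst_compProd, Measure.fst, Measure.map_map measurable_fst (by fun_prop)] at h
    exact h
  have h3 : (p.joint W).map (fun ω => ω.2) = W ∘ₘ p.inputLaw := by
    have h := congrArg Measure.snd h1
    rw [Measure.snd_compProd, Measure.snd, Measure.map_map measurable_snd (by fun_prop)] at h
    exact h
  rw [h1, h2, h3, ← Measure.compProd_const, klDiv_compProd_right, inputLaw,
    lintegral_map (measurable_klDiv W (Kernel.const _ _)) measurable_snd]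
  rfl

end Formulas

end IndInput

end

noncomputable section

/-! ### Uniform laws on finite sets. -/

section Empirical

variable {ι α : Type*} [MeasurableSpace α]

/-- The distribution of `g a` for `a` uniform on the finite set `s`. -/
def empirical (s : Finset ι) (g : ι → α) : Measure α :=
  ∑ a ∈ s, (s.card : ℝ≥0∞)⁻¹ • Measure.dirac (g a)

lemma lintegral_empirical (s : Finset ι) (g : ι → α) {f : α → ℝ≥0∞} (hf : Measurable f) :
    ∫⁻ x, f x ∂empirical s g = (s.card : ℝ≥0∞)⁻¹ * ∑ a ∈ s, f (g a) := by
  rw [empirical, lintegral_finsetSum_measure, Finset.mul_sum]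
  refine Finset.sum_congr rfl fun a _ => ?_
  rw [lintegral_smul_measure, lintegral_dirac' _ hf, smul_eq_mul]

lemma empirical_apply (s : Finset ι) (g : ι → α) {B : Set α} (hB : MeasurableSet B) :
    empirical s g B = (s.card : ℝ≥0∞)⁻¹ * ∑ a ∈ s, B.indicator 1 (g a) := by
  rw [← lintegral_indicator_one hB]
  exact lintegral_empirical s g (measurable_one.indicator hB)

lemma isProbabilityMeasure_empirical {s : Finset ι} (hs : s.Nonempty) (g : ι → α) :
    IsProbabilityMeasure (empirical s g) := by
  refine ⟨?_⟩
  rw [empirical_apply s g MeasurableSet.univ]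
  simp only [Set.indicator_univ, Pi.one_apply, Finset.sum_const, nsmul_eq_mul, mul_one]
  exact ENNReal.inv_mul_cancel (by exact_mod_cast hs.card_ne_zero) (by simp)

end Empirical

/-- Uniformity on a box is independence of the coordinates; this is how box-shaped fibres yield
conditional independence. -/
lemma pi_empirical {κ : Type*} [Fintype κ] [DecidableEq κ] {ι X : κ → Type*}
    [∀ j, MeasurableSpace (X j)] {s : ∀ j, Finset (ι j)} (hs : ∀ j, (s j).Nonempty)
    (g : ∀ j, ι j → X j) :
    Measure.pi (fun j => empirical (s j) (g j)) =
      empirical (Fintype.piFinset s) (fun w j => g j (w j)) := by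
  have := fun j => isProbabilityMeasure_empirical (hs j) (g j)
  refine Measure.pi_eq fun B hB => ?_
  rw [empirical_apply _ _ (MeasurableSet.univ_pi hB)]
  simp only [empirical_apply _ _ (hB _), Finset.prod_mul_distrib, Finset.prod_univ_sum,
    Fintype.card_piFinset, Nat.cast_prod]
  rw [ENNReal.prod_inv_distrib (by simp [Set.Pairwise])]
  congr 1
  refine Finset.sum_congr rfl fun w _ => ?_
  by_cases h : ∀ j, g j (w j) ∈ B j
  · rw [Set.indicator_of_mem (by simpa using h)]
    exact (Finset.prod_eq_one fun j _ => by simp [h j]).symm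
  · rw [Set.indicator_of_notMem (by simpa using h)]
    push Not at h
    obtain ⟨j, hj⟩ := h
    exact (Finset.prod_eq_zero (Finset.mem_univ j) (by simp [hj])).symm

/-- Averaging over the fibres of `f` and then over the whole space. -/
lemma sum_fiber_average {Ω T : Type*} [Fintype Ω] [DecidableEq T] (f : Ω → T)
    (H : Ω → Ω → ℝ≥0∞) (hH : ∀ w w' v, f w = f w' → H w v = H w' v) :
    ∑ w, (((Finset.univ.filter fun v => f v = f w).card : ℝ≥0∞)⁻¹ *
      ∑ v with f v = f w, H w v) = ∑ w, H w w := by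
  have h1 : ∀ w, (((Finset.univ.filter fun v => f v = f w).card : ℝ≥0∞)⁻¹ *
      ∑ v with f v = f w, H w v) = ∑ v, if f v = f w then
        ((Finset.univ.filter fun v' => f v' = f v).card : ℝ≥0∞)⁻¹ * H v v else 0 := by
    intro w
    rw [Finset.mul_sum, Finset.sum_filter]
    refine Finset.sum_congr rfl fun v _ => ?_
    split_ifs with h
    · rw [hH w v v h.symm, h]
    · rfl
  simp_rw [h1]
  rw [Finset.sum_comm]
  refine Finset.sum_congr rfl fun v _ => ?_
  rw [← Finset.sum_filter, Finset.sum_const, nsmul_eq_mul, ← mul_assoc]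
  have h2 : (Finset.univ.filter fun w => f v = f w) = Finset.univ.filter fun w => f w = f v := by
    ext w; simp [eq_comm]
  rw [h2, ENNReal.mul_inv_cancel, one_mul]
  · simp only [ne_eq, Nat.cast_eq_zero, Finset.card_eq_zero]
    exact Finset.Nonempty.ne_empty ⟨v, by simp⟩
  · simp

/-! ### Codes with box-shaped transcript fibres: the single-letter input and the converse. -/

/-- The encoding part of a code with a conference: a transcript all of whose fibres are boxes, and
codewords of which the `j`-th depends on the `j`-th message and the transcript only. -/
structure BoxCode (k : ℕ) (M : Fin k → ℕ) (T : Type*) (X : Fin k → Type u) (n : ℕ) where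
  transcript : (∀ j, Fin (M j)) → T
  word : (∀ j, Fin (M j)) → Fin n → ∀ j, X j
  box : ∀ w w' j, transcript w = transcript w' →
    transcript (Function.update w j (w' j)) = transcript w
  word_congr : ∀ w w' t j, transcript w = transcript w' → w j = w' j → word w t j = word w' t j

namespace BoxCode

open Classical in
/-- The values of the `j`-th message that are compatible with the transcript of `w`. -/
def compatible {k : ℕ} {M : Fin k → ℕ} {T : Type*} {X : Fin k → Type u} {n : ℕ}
    (c : BoxCode k M T X n) (w : ∀ j, Fin (M j)) (j : Fin k) : Finset (Fin (M j)) :=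
  Finset.univ.filter fun a => c.transcript (Function.update w j a) = c.transcript w

variable {k : ℕ} {M : Fin k → ℕ} {T : Type*} {X : Fin k → Type u} {n : ℕ} {Y : Type v}
  (c : BoxCode k M T X n)

lemma mem_compatible {w : ∀ j, Fin (M j)} {j : Fin k} {a : Fin (M j)} :
    a ∈ c.compatible w j ↔ c.transcript (Function.update w j a) = c.transcript w := by
  simp [compatible]

lemma compatible_nonempty (w : ∀ j, Fin (M j)) (j : Fin k) : (c.compatible w j).Nonempty :=
  ⟨w j, c.mem_compatible.2 (by simp)⟩

lemma compatible_congr {w w' : ∀ j, Fin (M j)} (h : c.transcript w = c.transcript w')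
    (j : Fin k) : c.compatible w j = c.compatible w' j := by
  have key : ∀ {v v' : ∀ j, Fin (M j)}, c.transcript v = c.transcript v' →
      c.compatible v j ⊆ c.compatible v' j := by
    intro v v' h a ha
    rw [mem_compatible] at ha ⊢
    have h' := c.box v' (Function.update v j a) j (h.symm.trans ha.symm)
    simpa using h'
  exact (key h).antisymm (key h.symm)

open Classical in
-- A fibre of the transcript is the product of its one-coordinate sections.
lemma piFinset_compatible (w : ∀ j, Fin (M j)) :
    Fintype.piFinset (c.compatible w) =
      Finset.univ.filter fun v => c.transcript v = c.transcript w := by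
  ext v
  simp only [Fintype.mem_piFinset, mem_compatible, Finset.mem_filter, Finset.mem_univ, true_and]
  refine ⟨fun h => ?_, fun h j => c.box w v j h.symm⟩
  -- Pass from `w` to `v` one coordinate at a time; `box` keeps the transcript fixed at each
  -- exchange.
  suffices hs : ∀ s : Finset (Fin k), c.transcript (s.piecewise v w) = c.transcript w by
    simpa using hs Finset.univ
  intro s
  induction s using Finset.induction_on with
  | empty => simp
  | insert j s _ ih =>
    have h' := c.box (s.piecewise v w) (Function.update w j (v j)) j (ih.trans (h j).symm)
    rw [Function.update_self] at h'
    rw [Finset.piecewise_insert, h', ih]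

variable [∀ j, MeasurableSpace (X j)]

/-- The distribution of the `t`-th symbol of the `j`-th codeword given the transcript of `w`. -/
def symbolLaw (t : Fin n) (w : ∀ j, Fin (M j)) (j : Fin k) : Measure (X j) :=
  empirical (c.compatible w j) fun a => c.word (Function.update w j a) t j

instance (t : Fin n) (w : ∀ j, Fin (M j)) (j : Fin k) :
    IsProbabilityMeasure (c.symbolLaw t w j) :=
  isProbabilityMeasure_empirical (c.compatible_nonempty w j) _

lemma symbolLaw_congr (t : Fin n) {w w' : ∀ j, Fin (M j)}
    (h : c.transcript w = c.transcript w') (j : Fin k) :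
    c.symbolLaw t w j = c.symbolLaw t w' j := by
  unfold symbolLaw empirical
  rw [c.compatible_congr h]
  refine Finset.sum_congr rfl fun a ha => ?_
  have ha' := c.mem_compatible.1 ha
  beta_reduce
  rw [← c.compatible_congr h, mem_compatible] at ha
  rw [c.word_congr (Function.update w j a) (Function.update w' j a) t j
    (ha.trans (h.trans ha'.symm)) (by simp)]

open Classical in
-- Given the transcript, the messages are uniform on a box and each symbol depends only on its own
-- message. Hence the true conditional law of the symbols at time `t` is a product law.
lemma pi_symbolLaw (t : Fin n) (w : ∀ j, Fin (M j)) :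
    Measure.pi (c.symbolLaw t w) =
      empirical (Finset.univ.filter fun v => c.transcript v = c.transcript w)
        fun v => c.word v t := by
  unfold symbolLaw
  rw [pi_empirical (c.compatible_nonempty w), c.piFinset_compatible]
  unfold empirical
  refine Finset.sum_congr rfl fun v hv => ?_
  have hv' := hv
  rw [← c.piFinset_compatible, Fintype.mem_piFinset] at hv'
  congr 2
  funext j
  exact c.word_congr _ _ t j ((c.mem_compatible.1 (hv' j)).trans (Finset.mem_filter.1 hv).2.symm)
    (by simp)

/-- Numbering of the pairs of a time and a message vector. -/
abbrev index (_ : BoxCode k M T X n) :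
    (Fin n × ∀ j, Fin (M j)) ≃ Fin (Fintype.card (Fin n × ∀ j, Fin (M j))) :=
  Fintype.equivFin _

variable [NeZero n] [∀ j, NeZero (M j)]

/-- The input distribution of a code: `U₀` is a uniform time together with the transcript of
uniform messages, represented by a uniform message vector. -/
def input : IndInput X (Fintype.card (Fin n × ∀ j, Fin (M j))) where
  pU := ⟨empirical Finset.univ id, by
    have : Nonempty (Fin (Fintype.card (Fin n × ∀ j, Fin (M j)))) :=
      ⟨c.index (0, fun _ => 0)⟩
    exact isProbabilityMeasure_empirical Finset.univ_nonempty id⟩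
  pX i j := ⟨c.symbolLaw (c.index.symm i).1 (c.index.symm i).2 j, inferInstance⟩

lemma inputKernel_input (t : Fin n) (w : ∀ j, Fin (M j)) :
    c.input.inputKernel (c.index (t, w)) = Measure.pi (c.symbolLaw t w) := by
  change Measure.pi (c.symbolLaw (c.index.symm (c.index (t, w))).1
    (c.index.symm (c.index (t, w))).2) = _
  rw [Equiv.symm_apply_apply]

/-- The number of pairs of a time and a message vector. -/
abbrev total (_ : BoxCode k M T X n) : ℝ := n * ∏ j, (M j : ℝ)

lemma total_pos : 0 < c.total := by
  have h : ∀ j, 0 < (M j : ℝ) := fun j => by exact_mod_cast NeZero.pos (M j)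
  have hn : 0 < (n : ℝ) := by exact_mod_cast NeZero.pos n
  exact mul_pos hn (Finset.prod_pos fun j _ => h j)

/-- A function that sees `w` only through its transcript cannot distinguish the conditionally
redrawn input from the actual codeword: averaging over a fibre and then over fibres is averaging
over all messages. This turns the informations of `input` into averages along the code. -/
lemma lintegral_inputMeasure {f : Fin (Fintype.card (Fin n × ∀ j, Fin (M j))) × (∀ j, X j) → ℝ≥0∞}
    (hf : Measurable f) (hc : ∀ t w w' x, c.transcript w = c.transcript w' →
      f (c.index (t, w), x) = f (c.index (t, w'), x)) :
    ∫⁻ z, f z ∂c.input.inputMeasure =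
      (ENNReal.ofReal c.total)⁻¹ * ∑ w, ∑ t, f (c.index (t, w), c.word w t) := by
  classical
  rw [IndInput.lintegral_inputMeasure _ hf]
  change ∫⁻ i, _ ∂(empirical Finset.univ id) = _
  rw [lintegral_empirical _ _ (measurable_of_finite _), Finset.card_univ, Fintype.card_fin]
  congr 1
  · rw [total, Fintype.card_prod, Fintype.card_fin, Fintype.card_pi, ← Nat.cast_prod,
      ← Nat.cast_mul, ENNReal.ofReal_natCast]
    simp
  · rw [← Equiv.sum_comp c.index, Fintype.sum_prod_type]
    conv_rhs => rw [Finset.sum_comm]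
    refine (Finset.sum_congr rfl fun t _ => ?_)
    simp only [id]
    rw [← sum_fiber_average c.transcript (fun w v => f (c.index (t, w), c.word v t))
      fun w w' v h => hc t w w' _ h]
    refine Finset.sum_congr rfl fun w _ => ?_
    have hf1 : Measurable fun x => f (c.index (t, w), x) := hf.comp measurable_prodMk_left
    rw [inputKernel_input, pi_symbolLaw, lintegral_empirical _ _ hf1]

lemma satisfiesCost {b : ∀ j, X j → ℝ≥0} (hb : ∀ j, Measurable (b j)) {B : Fin k → ℝ≥0}
    (hcost : ∀ w j, ∑ t, b j (c.word w t j) ≤ n * B j) : c.input.SatisfiesCost b B := by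
  intro j
  change ∫⁻ z, (b j (z.2 j) : ℝ≥0∞) ∂c.input.inputMeasure ≤ B j
  rw [c.lintegral_inputMeasure (f := fun z => (b j (z.2 j) : ℝ≥0∞)) (by fun_prop)
    fun _ _ _ _ _ => rfl]
  calc _ ≤ (ENNReal.ofReal c.total)⁻¹ * ∑ w : (∀ j, Fin (M j)), ((n * B j : ℝ≥0) : ℝ≥0∞) := by
        gcongr with w
        rw [← ENNReal.ofNNReal_finsetSum]
        exact_mod_cast hcost w j
    _ = (ENNReal.ofReal c.total)⁻¹ * (ENNReal.ofReal c.total * B j) := by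
        congr 1
        rw [Finset.sum_const, nsmul_eq_mul, Finset.card_univ, Fintype.card_pi, total,
          ← Nat.cast_prod, ← Nat.cast_mul, ENNReal.ofReal_natCast]
        simp only [Fintype.card_fin]
        push_cast
        ring
    _ = B j := by
        rw [← mul_assoc, ENNReal.inv_mul_cancel, one_mul]
        · exact (ENNReal.ofReal_pos.2 c.total_pos).ne'
        · exact ENNReal.ofReal_ne_top

variable [MeasurableSpace Y] (W : Kernel (∀ j, X j) Y) [IsMarkovKernel W]

/-- Evaluated at the codewords, this makes the reference law a function of the key, since the
transcript and the messages outside `S` fix the codewords outside `S`. -/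
lemma outKernel_congr (S : Finset (Fin k)) (t : Fin n) {w w' : ∀ j, Fin (M j)}
    (h : c.transcript w = c.transcript w') {x x' : ∀ j, X j} (hx : ∀ j ∉ S, x j = x' j) :
    c.input.outKernel W S (c.index (t, w), x) = c.input.outKernel W S (c.index (t, w'), x') := by
  rw [IndInput.outKernel_apply, IndInput.outKernel_apply, inputKernel_input, inputKernel_input,
    funext (c.symbolLaw_congr t h)]
  congr 2
  funext z j
  by_cases hj : j ∈ S
  · simp [hj]
  · simp [hj, hx j hj]

variable [∀ j, StandardBorelSpace (X j)] [∀ j, Nonempty (X j)] [StandardBorelSpace Y] [Nonempty Y]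

/-- The distribution of the channel output sequence when the messages are `w`. -/
abbrev output (w : ∀ j, Fin (M j)) : Measure (Fin n → Y) :=
  Measure.pi fun t => W (c.word w t)

/-- The average probability of correct decoding. -/
abbrev success (decode : (Fin n → Y) → ∀ j, Fin (M j)) : ℝ :=
  (∑ w, (c.output W w).real {y | decode y = w}) / ∏ j, (M j : ℝ)

/-- A reference output distribution depending on a key with values in `K` bounds the logarithm of
the number of messages per key. -/
lemma ofReal_le_of_key {K : Type*} [Fintype K] [Nonempty K] (key : (∀ j, Fin (M j)) → K)
    (R : (∀ j, Fin (M j)) → Fin n → Measure Y) [∀ w t, IsProbabilityMeasure (R w t)]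
    (hR : ∀ w w', key w = key w' → R w = R w')
    {decode : (Fin n → Y) → ∀ j, Fin (M j)} (hdec : Measurable decode) :
    ENNReal.ofReal ((Real.log ((∏ j, (M j : ℝ)) / Fintype.card K) * c.success W decode
        - Real.log 2) / (n * Real.log 2)) ≤
      (ENNReal.ofReal c.total)⁻¹ * (∑ w, ∑ t, klDiv (W (c.word w t)) (R w t)) /
        ENNReal.ofReal (Real.log 2) := by
  have hA : ∀ w, MeasurableSet {y | decode y = w} := fun w => hdec (measurableSet_singleton w)
  have hM : 0 < ∏ j, (M j : ℝ) :=
    Finset.prod_pos fun j _ => by exact_mod_cast NeZero.pos (M j)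
  have hn : 0 < (n : ℝ) := by exact_mod_cast NeZero.pos n
  have hl : 0 < Real.log 2 := Real.log_pos one_lt_two
  have hcard : ((Fintype.card (∀ j, Fin (M j)) : ℕ) : ℝ) = ∏ j, (M j : ℝ) := by
    simp [Fintype.card_pi]
  have h1 := sum_real_le_card (fun w => Measure.pi (R w)) key (fun w w' h => by rw [hR w w' h])
    (fun w => {y | decode y = w}) hA (fun w w' hne => Set.disjoint_left.2 fun y h h' => hne
      (Eq.trans (Eq.symm h) h'))
  have h2 := ofReal_le_sum_klDiv (fun w => c.output W w) (fun w => Measure.pi (R w))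
    (fun w => {y | decode y = w}) hA (K := Fintype.card K)
    (by exact_mod_cast Fintype.card_pos) h1
  have h3 : ∑ w, klDiv (c.output W w) (Measure.pi (R w)) ≤
      ∑ w, ∑ t, klDiv (W (c.word w t)) (R w t) :=
    Finset.sum_le_sum fun w _ => klDiv_pi_le _ _
  rw [hcard] at h2
  calc _ = (ENNReal.ofReal c.total)⁻¹ * ENNReal.ofReal (
        Real.log ((∏ j, (M j : ℝ)) / Fintype.card K)
        * ∑ w, (c.output W w).real {y | decode y = w} - (∏ j, (M j : ℝ)) * Real.log 2) /
        ENNReal.ofReal (Real.log 2) := by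
        rw [← ENNReal.ofReal_inv_of_pos c.total_pos,
          ← ENNReal.ofReal_mul (inv_nonneg.2 c.total_pos.le), ← ENNReal.ofReal_div_of_pos hl]
        congr 1
        rw [success, total]
        field_simp
    _ ≤ _ := by
        gcongr
        exact h2.trans h3

/-- The converse bound for the messages in `S`. -/
lemma ofReal_le_condInfo (S : Finset (Fin k)) {K : Type*} [Fintype K]
    (key : (∀ j, Fin (M j)) → K)
    (hkey : ∀ w w', key w = key w' → c.transcript w = c.transcript w' ∧ ∀ j ∉ S, w j = w' j)
    {decode : (Fin n → Y) → ∀ j, Fin (M j)} (hdec : Measurable decode) :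
    ENNReal.ofReal ((Real.log ((∏ j, (M j : ℝ)) / Fintype.card K) * c.success W decode
        - Real.log 2) / (n * Real.log 2)) ≤ c.input.condInfo W S := by
  have : Nonempty K := ⟨key fun _ => 0⟩
  rw [IndInput.condInfo_eq, c.lintegral_inputMeasure (IndInput.measurable_klDiv_outKernel _ W S)
    fun t w w' x h => by rw [c.outKernel_congr W S t h fun _ _ => rfl]]
  exact c.ofReal_le_of_key W key
    (fun w t => c.input.outKernel W S (c.index (t, w), c.word w t))
    (fun w w' h => funext fun t => c.outKernel_congr W S t (hkey w w' h).1 fun j hj =>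
      c.word_congr w w' t j (hkey w w' h).1 ((hkey w w' h).2 j hj)) hdec

/-- The converse bound for all the messages. -/
lemma ofReal_le_info {decode : (Fin n → Y) → ∀ j, Fin (M j)} (hdec : Measurable decode) :
    ENNReal.ofReal ((Real.log (∏ j, (M j : ℝ)) * c.success W decode
        - Real.log 2) / (n * Real.log 2)) ≤ c.input.info W := by
  have hm : Measurable fun z : Fin (Fintype.card (Fin n × ∀ j, Fin (M j))) × (∀ j, X j) =>
      klDiv (W z.2) (W ∘ₘ c.input.inputLaw) :=
    (measurable_klDiv W (Kernel.const _ (W ∘ₘ c.input.inputLaw))).comp measurable_snd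
  rw [IndInput.info_eq, c.lintegral_inputMeasure hm fun _ _ _ _ _ => rfl]
  -- The reference law ignores the messages, so one key suffices and no link capacity enters.
  have h := c.ofReal_le_of_key W (fun _ => ()) (fun _ _ => W ∘ₘ c.input.inputLaw)
    (fun _ _ _ => rfl) hdec
  simpa using h

end BoxCode

end

/-! ### Conference codes, the converse at fixed blocklength, and its limit. -/

noncomputable section

variable {k : ℕ} {X : Fin k → Type u} {Y : Type v} [MeasurableSpace Y]

/-- Total capacity of the links leaving the encoders in `S`. -/
abbrev linkCapacity (C : Fin k → Fin k → ℝ≥0) (S : Finset (Fin k)) : ℝ≥0 :=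
  ∑ j ∈ S, ∑ i ∈ Finset.univ.erase j, C j i

namespace Code

variable {b : ∀ j, X j → ℝ≥0} {B : Fin k → ℝ≥0} {C : Fin k → Fin k → ℝ≥0}
  {M : Fin k → ℕ} {n L : ℕ}

/-- The rectangle property, by induction on the rounds. Having received the same symbols so far,
encoder `j` acts as under `w'` and the others as under `w`, and both behaviours give the same
symbols. -/
lemma symbol_update (c : Code (Y := Y) b B C M n L) {w w' : ∀ j, Fin (M j)} (j : Fin k)
    (h : ∀ ℓ j i, c.symbol w ℓ j i = c.symbol w' ℓ j i) (ℓ : Fin L) :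
    ∀ j' i, c.symbol (Function.update w j (w' j)) ℓ j' i = c.symbol w ℓ j' i := by
  induction ℓ using WellFoundedLT.induction with
  | ind ℓ ih =>
    intro j' i
    by_cases hj : j' = j
    · subst hj
      rw [h, Code.symbol, Code.symbol, Function.update_self]
      congr 1
      funext i' ℓ' hℓ
      rw [ih ℓ' hℓ, h]
    · rw [Code.symbol, Code.symbol, Function.update_of_ne hj]
      congr 1
      funext i' ℓ' hℓ
      rw [ih ℓ' hℓ]

/-- Messages outside `S` and the symbols sent by `S` determine the whole conference. -/
lemma symbol_congr_of_sent (c : Code (Y := Y) b B C M n L) {w w' : ∀ j, Fin (M j)}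
    {S : Finset (Fin k)} (hw : ∀ j ∉ S, w j = w' j)
    (h : ∀ j ∈ S, ∀ i ℓ, c.symbol w ℓ j i = c.symbol w' ℓ j i) (ℓ : Fin L) :
    ∀ j i, c.symbol w ℓ j i = c.symbol w' ℓ j i := by
  induction ℓ using WellFoundedLT.induction with
  | ind ℓ ih =>
    intro j i
    by_cases hj : j ∈ S
    · exact h j hj i ℓ
    · rw [Code.symbol, Code.symbol, hw j hj]
      congr 1
      funext i' ℓ' hℓ
      rw [ih ℓ' hℓ]

/-- The encoding part of a code. -/
def toBoxCode (c : Code (Y := Y) b B C M n L) :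
    BoxCode k M (∀ (ℓ : Fin L) (j : Fin k) (i : {i : Fin k // i ≠ j}), Fin (c.size j i ℓ)) X n where
  transcript w ℓ j i := c.symbol w ℓ j i
  word w t j := c.codeword w j t
  box w w' j h := by
    have h' : ∀ ℓ j i, c.symbol w ℓ j i = c.symbol w' ℓ j i := fun ℓ j i =>
      congrFun (congrFun (congrFun h ℓ) j) i
    funext ℓ j' i
    exact c.symbol_update j h' ℓ j' i
  word_congr w w' t j h hw := by
    have h' : ∀ ℓ j i, c.symbol w ℓ j i = c.symbol w' ℓ j i := fun ℓ j i =>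
      congrFun (congrFun (congrFun h ℓ) j) i
    unfold codeword
    rw [hw]
    congr 1
    funext i ℓ
    exact h' ℓ i _

/-- The messages outside `S` and the symbols sent by `S`. -/
abbrev Key (c : Code (Y := Y) b B C M n L) (S : Finset (Fin k)) : Type :=
  (∀ j : (Sᶜ : Finset (Fin k)), Fin (M j)) ×
    (∀ (j : S) (i : {i : Fin k // i ≠ j}) (ℓ : Fin L), Fin (c.size j i ℓ))

/-- The key of a message vector. -/
def key (c : Code (Y := Y) b B C M n L) (S : Finset (Fin k)) (w : ∀ j, Fin (M j)) : c.Key S :=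
  (fun j => w j, fun j i ℓ => c.symbol w ℓ j i)

lemma key_spec (c : Code (Y := Y) b B C M n L) (S : Finset (Fin k)) (w w' : ∀ j, Fin (M j))
    (h : c.key S w = c.key S w') :
    c.toBoxCode.transcript w = c.toBoxCode.transcript w' ∧ ∀ j ∉ S, w j = w' j := by
  have hw : ∀ j ∉ S, w j = w' j := fun j hj =>
    congrFun (congrArg Prod.fst h) ⟨j, Finset.mem_compl.2 hj⟩
  refine ⟨?_, hw⟩
  funext ℓ j i
  exact c.symbol_congr_of_sent hw (fun j hj i ℓ =>
    congrFun (congrFun (congrFun (congrArg Prod.snd h) ⟨j, hj⟩) i) ℓ) ℓ j i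

lemma logb_card_key_le (c : Code (Y := Y) b B C M n L) (S : Finset (Fin k))
    (hM : ∀ j, 0 < M j) :
    Real.logb 2 (Fintype.card (c.Key S)) ≤
      ∑ j ∈ Sᶜ, Real.logb 2 (M j) + n * linkCapacity C S := by
  have hs : ∀ i j ℓ, (c.size i j ℓ : ℝ) ≠ 0 := fun i j ℓ => by
    exact_mod_cast (c.size_pos i j ℓ).ne'
  have hM' : ∀ j, (M j : ℝ) ≠ 0 := fun j => by exact_mod_cast (hM j).ne'
  simp only [Fintype.card_prod, Fintype.card_pi, Fintype.card_fin, Nat.cast_mul, Nat.cast_prod]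
  have hs1 : ∀ (j : S) (i : {i : Fin k // i ≠ j}), ∏ ℓ, (c.size j i ℓ : ℝ) ≠ 0 := fun j i =>
    Finset.prod_ne_zero_iff.2 fun ℓ _ => hs _ _ _
  have hs2 : ∀ j : S, ∏ i : {i : Fin k // i ≠ j}, ∏ ℓ, (c.size j i ℓ : ℝ) ≠ 0 := fun j =>
    Finset.prod_ne_zero_iff.2 fun i _ => hs1 j i
  rw [Real.logb_mul
      (Finset.prod_ne_zero_iff.2 fun (j : (Sᶜ : Finset (Fin k))) _ => hM' j)
    (Finset.prod_ne_zero_iff.2 fun j _ => hs2 j),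
    Real.logb_prod _ _ fun (j : (Sᶜ : Finset (Fin k))) _ => hM' j,
    Real.logb_prod _ _ fun j _ => hs2 j]
  rw [Finset.sum_coe_sort Sᶜ fun j => Real.logb 2 (M j : ℝ)]
  gcongr
  rw [linkCapacity]
  push_cast
  rw [Finset.mul_sum, ← Finset.sum_coe_sort S]
  refine Finset.sum_le_sum fun j _ => ?_
  rw [Real.logb_prod _ _ (fun i _ => hs1 j i), Finset.mul_sum]
  have h2 : ∑ i ∈ Finset.univ.erase (j : Fin k), (n : ℝ) * (C j i : ℝ) =
      ∑ i : {i : Fin k // i ≠ j}, (n : ℝ) * (C j i : ℝ) :=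
    Finset.sum_subtype _ (by simp) fun i => (n : ℝ) * (C j i : ℝ)
  rw [h2]
  refine Finset.sum_le_sum fun i _ => ?_
  rw [Real.logb_prod _ _ (fun ℓ _ => hs _ _ _)]
  exact c.size_le j i i.2.symm

variable [∀ j, MeasurableSpace (X j)] (W : Kernel (∀ j, X j) Y) [IsMarkovKernel W]

lemma success_eq (c : Code (Y := Y) b B C M n L) (hM : ∀ j, 0 < M j) :
    c.toBoxCode.success W c.decode = 1 - c.errorProb W := by
  have hN : (∏ j, (M j : ℝ)) ≠ 0 :=
    Finset.prod_ne_zero_iff.2 fun j _ => by exact_mod_cast (hM j).ne'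
  rw [BoxCode.success, errorProb, eq_sub_iff_add_eq, ← add_div, ← Finset.sum_add_distrib,
    div_eq_one_iff_eq hN]
  have h : ∀ w, (c.toBoxCode.output W w).real {y | c.decode y = w} +
      (Measure.pi (fun t : Fin n => W (fun j => c.codeword w j t))).real {y | c.decode y ≠ w} = 1 :=
    fun w => probReal_add_probReal_compl (μ := c.toBoxCode.output W w)
      (c.measurable_decode (measurableSet_singleton w))
  simp [h, Fintype.card_pi]

lemma errorProb_nonneg (c : Code (Y := Y) b B C M n L) : 0 ≤ c.errorProb W :=
  div_nonneg (Finset.sum_nonneg fun _ _ => measureReal_nonneg)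
    (Finset.prod_nonneg fun _ _ => Nat.cast_nonneg _)

variable [∀ j, StandardBorelSpace (X j)] [∀ j, Nonempty (X j)] [StandardBorelSpace Y] [Nonempty Y]

/-- The converse at a fixed blocklength. -/
lemma exists_input (hb : ∀ j, Measurable (b j)) {R : Fin k → ℝ}
    (c : Code (Y := Y) b B C (fun j => ⌈(2 : ℝ) ^ ((n : ℝ) * R j)⌉₊) n L) (hn : 0 < n) :
    ∃ (m : ℕ) (p : IndInput X m), p.SatisfiesCost b B ∧
      (∀ S : Finset (Fin k), ENNReal.ofReal ((∑ j ∈ S, R j - linkCapacity C S) *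
        (1 - c.errorProb W) - 1 / n) ≤ p.condInfo W S) ∧
      ENNReal.ofReal ((∑ j, R j) * (1 - c.errorProb W) - 1 / n) ≤ p.info W := by
  have hMpos : ∀ j, 0 < ⌈(2 : ℝ) ^ ((n : ℝ) * R j)⌉₊ := fun j => Nat.ceil_pos.2 (by positivity)
  have : NeZero n := ⟨hn.ne'⟩
  have : ∀ j, NeZero ⌈(2 : ℝ) ^ ((n : ℝ) * R j)⌉₊ := fun j => ⟨(hMpos j).ne'⟩
  have hn' : 0 < (n : ℝ) := by exact_mod_cast hn
  have hl : 0 < Real.log 2 := Real.log_pos one_lt_two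
  have hM0 : ∀ j, ((⌈(2 : ℝ) ^ ((n : ℝ) * R j)⌉₊ : ℕ) : ℝ) ≠ 0 := fun j => by
    exact_mod_cast (hMpos j).ne'
  have hMge : ∀ j, n * R j ≤ Real.logb 2 (⌈(2 : ℝ) ^ ((n : ℝ) * R j)⌉₊ : ℕ) := fun j => by
    rw [Real.le_logb_iff_rpow_le one_lt_two (by exact_mod_cast hMpos j)]
    exact Nat.le_ceil _
  have hsucc : 0 ≤ 1 - c.errorProb W := by
    rw [← c.success_eq W hMpos]
    exact div_nonneg (Finset.sum_nonneg fun _ _ => measureReal_nonneg)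
      (Finset.prod_nonneg fun _ _ => Nat.cast_nonneg _)
  -- Conversion to bits per channel use: `a` is the logarithm of the number of messages per key, and
  -- the loss `log 2` becomes `1 / n`.
  have hfin : ∀ a r : ℝ, n * r ≤ a / Real.log 2 → r * (1 - c.errorProb W) - 1 / n ≤
      (a * (1 - c.errorProb W) - Real.log 2) / (n * Real.log 2) := by
    intro a r h
    have h1 := mul_le_mul_of_nonneg_right h hsucc
    have h2 : (a * (1 - c.errorProb W) - Real.log 2) / (n * Real.log 2) =
        (a / Real.log 2 * (1 - c.errorProb W) - 1) / n := by field_simp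
    rw [h2, le_div_iff₀ hn', sub_mul, one_div, inv_mul_cancel₀ hn'.ne']
    linarith
  refine ⟨_, c.toBoxCode.input, c.toBoxCode.satisfiesCost hb fun w j => c.encode_cost _ _ _,
    fun S => ?_, ?_⟩
  · refine le_trans (ENNReal.ofReal_le_ofReal ?_)
      (c.toBoxCode.ofReal_le_condInfo W S (c.key S) (c.key_spec S) c.measurable_decode)
    rw [c.success_eq W hMpos]
    refine hfin _ _ ?_
    have hK : (Fintype.card (c.Key S) : ℝ) ≠ 0 := by
      have : Nonempty (c.Key S) := ⟨c.key S fun _ => 0⟩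
      exact_mod_cast Fintype.card_ne_zero
    change _ ≤ Real.logb 2 _
    rw [Real.logb_div (Finset.prod_ne_zero_iff.2 fun j _ => hM0 j) hK,
      Real.logb_prod _ _ (fun j _ => hM0 j), ← Finset.sum_add_sum_compl S]
    have h1 := c.logb_card_key_le S hMpos
    have h2 : ∑ j ∈ S, n * R j ≤ ∑ j ∈ S, Real.logb 2 (⌈(2 : ℝ) ^ ((n : ℝ) * R j)⌉₊ : ℕ) :=
      Finset.sum_le_sum fun j _ => hMge j
    rw [← Finset.mul_sum] at h2
    rw [mul_sub]
    linarith
  · refine le_trans (ENNReal.ofReal_le_ofReal ?_)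
      (c.toBoxCode.ofReal_le_info W c.measurable_decode)
    rw [c.success_eq W hMpos]
    refine hfin _ _ ?_
    change _ ≤ Real.logb 2 _
    rw [Real.logb_prod _ _ (fun j _ => hM0 j), Finset.mul_sum]
    exact Finset.sum_le_sum fun j _ => hMge j

end Code

variable [∀ j, MeasurableSpace (X j)] [∀ j, StandardBorelSpace (X j)] [∀ j, Nonempty (X j)]
  [StandardBorelSpace Y] [Nonempty Y]
  (W : Kernel (∀ j, X j) Y) [IsMarkovKernel W] {b : ∀ j, X j → ℝ≥0}
  {B : Fin k → ℝ≥0} {C : Fin k → Fin k → ℝ≥0}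

/-- Scaled-down rates of a code lie in the outer region. -/
lemma Code.smul_mem_outerRegion (hb : ∀ j, Measurable (b j)) {R : Fin k → ℝ} (hR : ∀ j, 0 ≤ R j)
    {n L : ℕ} (c : Code (Y := Y) b B C (fun j => ⌈(2 : ℝ) ^ ((n : ℝ) * R j)⌉₊) n L) (hn : 0 < n)
    {r : ℝ} (hr : 0 < r) (hrR : ∀ S : Finset (Fin k), ∑ j ∈ S, R j = 0 ∨ r ≤ ∑ j ∈ S, R j) :
    max 0 (1 - c.errorProb W - 1 / n / r) • R ∈ outerRegion W b B C := by
  obtain ⟨m, p, hcost, hS, htot⟩ := c.exists_input W hb hn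
  have hn' : 0 < (n : ℝ) := by exact_mod_cast hn
  have he := c.errorProb_nonneg W
  set ε := c.errorProb W
  -- A nonzero partial sum is at least `r`, so the additive loss `1 / n` is at most a fraction `1 /
  -- (n r)` of it. Zero sums need no bound, and the maximum keeps the rates nonnegative.
  set θ := max 0 (1 - ε - 1 / n / r) with hθ
  have hθ0 : 0 ≤ θ := le_max_left _ _
  have key : ∀ S : Finset (Fin k), ∑ j ∈ S, (θ • R) j = 0 ∨
      ∑ j ∈ S, (θ • R) j ≤ (∑ j ∈ S, R j) * (1 - ε) - 1 / n := by
    intro S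
    simp only [Pi.smul_apply, smul_eq_mul, ← Finset.mul_sum]
    rcases le_total (1 - ε - 1 / n / r) 0 with h | h
    · left; rw [hθ, max_eq_left h, zero_mul]
    rcases hrR S with h0 | h0
    · left; rw [h0, mul_zero]
    · right
      rw [hθ, max_eq_right h]
      have h1 : 1 / (n : ℝ) ≤ 1 / n / r * ∑ j ∈ S, R j := by
        calc 1 / (n : ℝ) = 1 / n / r * r := by field_simp
          _ ≤ _ := by gcongr
      linarith
  refine ⟨fun j => mul_nonneg hθ0 (hR j), m, p, hcost, fun S _ => ?_, ?_⟩
  · rcases key S with h | h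
    · rw [h]; simp
    · have hC : (∑ j ∈ S, ∑ i ∈ Finset.univ.erase j, (C j i : ℝ≥0∞)) =
          ENNReal.ofReal (linkCapacity C S) := by
        rw [ENNReal.ofReal_coe_nnreal]
        push_cast
        rfl
      rw [hC]
      calc _ ≤ ENNReal.ofReal (((∑ j ∈ S, R j - linkCapacity C S) * (1 - ε) - 1 / n) +
            linkCapacity C S) := by
            refine ENNReal.ofReal_le_ofReal (h.trans ?_)
            have : 0 ≤ (linkCapacity C S : ℝ) * ε := by positivity
            linarith
        _ ≤ _ := ENNReal.ofReal_add_le.trans (by gcongr; exact hS S)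
  · rcases key Finset.univ with h | h
    · rw [h]; simp
    · exact (ENNReal.ofReal_le_ofReal h).trans htot

lemma IsAchievable.mem_closure_outerRegion (hb : ∀ j, Measurable (b j)) {Λ : Set ℕ}
    {R : Fin k → ℝ} (h : IsAchievable W b B C Λ R) : R ∈ closure (outerRegion W b B C) := by
  obtain ⟨hR, L, -, c, hc⟩ := h
  obtain ⟨r, hr, hrR⟩ : ∃ r : ℝ, 0 < r ∧ ∀ S : Finset (Fin k),
      ∑ j ∈ S, R j = 0 ∨ r ≤ ∑ j ∈ S, R j := by
    refine ⟨Finset.univ.inf' Finset.univ_nonempty fun S : Finset (Fin k) =>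
      if ∑ j ∈ S, R j = 0 then 1 else ∑ j ∈ S, R j, ?_, fun S => ?_⟩
    · rw [Finset.lt_inf'_iff]
      intro S _
      split_ifs with h
      · exact one_pos
      · exact lt_of_le_of_ne (Finset.sum_nonneg fun j _ => hR j) (Ne.symm h)
    · by_cases h : ∑ j ∈ S, R j = 0
      · exact Or.inl h
      · refine Or.inr ((Finset.inf'_le _ (Finset.mem_univ S)).trans ?_)
        rw [if_neg h]
  have hlim : Tendsto (fun n : ℕ => max 0 (1 - (c n).errorProb W - 1 / (n : ℝ) / r) • R) atTop
      (𝓝 R) := by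
    have h1 : Tendsto (fun n : ℕ => max 0 (1 - (c n).errorProb W - 1 / (n : ℝ) / r)) atTop
        (𝓝 (max 0 (1 - 0 - 0 / r))) :=
      tendsto_const_nhds.max ((tendsto_const_nhds.sub hc).sub
        (tendsto_one_div_atTop_nhds_zero_nat.div_const r))
    have h2 := h1.smul_const R
    simpa using h2
  refine mem_closure_of_tendsto hlim ?_
  filter_upwards [eventually_gt_atTop 0] with n hn
  exact (c n).smul_mem_outerRegion W hb hR hn hr hrR

/-- The outer bound up to closure. -/
theorem capacityRegion_subset_closure (hb : ∀ j, Measurable (b j)) (Λ : Set ℕ) :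
    capacityRegion W b B C Λ ⊆ closure (outerRegion W b B C) :=
  closure_minimal (fun _ h => IsAchievable.mem_closure_outerRegion W hb h) isClosed_closure

end

noncomputable section

/-! ### Continuity of mutual information for finitely many input symbols and arbitrary output. -/

section FiniteMixtures

variable {ι Y : Type*} [Fintype ι] [MeasurableSpace Y]

/-- The mixture of the measures `ν i` with weights `p i`. -/
def mix (ν : ι → Measure Y) (p : ι → ℝ) : Measure Y := ∑ i, ENNReal.ofReal (p i) • ν i

/-- The mutual information (in nats) of an input with law `p` and the output of the channel `ν`. -/
def mutualSum (ν : ι → Measure Y) (p : ι → ℝ) : ℝ :=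
  ∑ i, p i * (klDiv (ν i) (mix ν p)).toReal

variable (ν : ι → Measure Y) [∀ i, IsProbabilityMeasure (ν i)]

lemma isProbabilityMeasure_mix {p : ι → ℝ} (hp : p ∈ stdSimplex ℝ ι) :
    IsProbabilityMeasure (mix ν p) := by
  refine ⟨?_⟩
  simp only [mix, Measure.coe_finsetSum, Finset.sum_apply, Measure.smul_apply, measure_univ,
    smul_eq_mul, mul_one]
  rw [← ENNReal.ofReal_sum_of_nonneg fun i _ => hp.1 i, hp.2, ENNReal.ofReal_one]

/-- A dominating measure. -/
abbrev domMeasure : Measure Y := ∑ i, ν i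

lemma le_domMeasure (i : ι) : ν i ≤ domMeasure ν := by
  refine Measure.le_iff.2 fun s _ => ?_
  rw [Measure.coe_finsetSum, Finset.sum_apply]
  exact Finset.single_le_sum (f := fun i => ν i s) (fun _ _ => zero_le) (Finset.mem_univ i)

lemma ac_domMeasure (i : ι) : ν i ≪ domMeasure ν := (le_domMeasure ν i).absolutelyContinuous

/-- The density of `ν i` with respect to the dominating measure. -/
def dens (i : ι) (y : Y) : ℝ := ((ν i).rnDeriv (domMeasure ν) y).toReal

lemma measurable_dens (i : ι) : Measurable (dens ν i) :=
  (Measure.measurable_rnDeriv _ _).ennreal_toReal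

lemma dens_nonneg (i : ι) (y : Y) : 0 ≤ dens ν i y := ENNReal.toReal_nonneg

lemma ae_dens_le_one : ∀ᵐ y ∂domMeasure ν, ∀ i, dens ν i y ≤ 1 := by
  rw [ae_all_iff]
  intro i
  filter_upwards [Measure.rnDeriv_le_one_of_le (le_domMeasure ν i)] with y hy
  exact ENNReal.toReal_le_of_le_ofReal zero_le_one (by simpa using hy)

lemma rnDeriv_mix {p : ι → ℝ} (hp : p ∈ stdSimplex ℝ ι) :
    ∀ᵐ y ∂domMeasure ν, ((mix ν p).rnDeriv (domMeasure ν) y).toReal = ∑ i, p i * dens ν i y := by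
  have h : mix ν p = (domMeasure ν).withDensity fun y =>
      ∑ i, ENNReal.ofReal (p i) * (ν i).rnDeriv (domMeasure ν) y := by
    ext s hs
    rw [withDensity_apply _ hs, lintegral_finsetSum _ fun i _ =>
      (Measure.measurable_rnDeriv _ _).const_mul _]
    simp only [mix, Measure.coe_finsetSum, Finset.sum_apply, Measure.smul_apply, smul_eq_mul]
    refine Finset.sum_congr rfl fun i _ => ?_
    rw [lintegral_const_mul _ (Measure.measurable_rnDeriv _ _),
      Measure.setLIntegral_rnDeriv (ac_domMeasure ν i)]
  have hm : Measurable fun y => ∑ i, ENNReal.ofReal (p i) * (ν i).rnDeriv (domMeasure ν) y :=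
    Finset.measurable_fun_sum _ fun i _ => (Measure.measurable_rnDeriv _ _).const_mul _
  have htop : ∀ᵐ y ∂domMeasure ν, ∀ i, (ν i).rnDeriv (domMeasure ν) y < ∞ :=
    ae_all_iff.2 fun i => Measure.rnDeriv_lt_top _ _
  rw [h]
  filter_upwards [Measure.rnDeriv_withDensity (domMeasure ν) hm, htop] with y hy ht
  rw [hy, ENNReal.toReal_sum fun i _ => ENNReal.mul_ne_top ENNReal.ofReal_ne_top (ht i).ne]
  refine Finset.sum_congr rfl fun i _ => ?_
  rw [ENNReal.toReal_mul, ENNReal.toReal_ofReal (hp.1 i), dens]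

lemma ac_mix {p : ι → ℝ} (hp : p ∈ stdSimplex ℝ ι) {i : ι} (hi : p i ≠ 0) : ν i ≪ mix ν p := by
  refine Measure.AbsolutelyContinuous.mk fun s _ h => ?_
  simp only [mix, Measure.coe_finsetSum, Finset.sum_apply, Measure.smul_apply, smul_eq_mul,
    Finset.sum_eq_zero_iff, Finset.mem_univ, true_implies] at h
  refine (mul_eq_zero.1 (h i)).resolve_left ?_
  exact (ENNReal.ofReal_pos.2 (lt_of_le_of_ne (hp.1 i) hi.symm)).ne'

/-- The chain rule for densities; the factor `dens ν i y` removes the points where the logarithm of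
a zero density would matter. -/
lemma dens_mul_llr {p : ι → ℝ} (hp : p ∈ stdSimplex ℝ ι) {i : ι} (hi : p i ≠ 0) :
    ∀ᵐ y ∂domMeasure ν, dens ν i y * llr (ν i) (mix ν p) y =
      dens ν i y * (Real.log (dens ν i y) - Real.log (∑ i, p i * dens ν i y)) := by
  have := isProbabilityMeasure_mix ν hp
  filter_upwards [Measure.rnDeriv_mul_rnDeriv (ac_mix ν hp hi) (κ := domMeasure ν),
    rnDeriv_mix ν hp] with y h1 h2
  by_cases h0 : dens ν i y = 0
  · rw [h0, zero_mul, zero_mul]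
  · have h3 : dens ν i y = ((ν i).rnDeriv (mix ν p) y).toReal * ∑ i, p i * dens ν i y := by
      rw [← h2, ← ENNReal.toReal_mul, dens, ← h1]
      rfl
    have h4 := h0
    rw [h3] at h4
    conv_rhs => rw [h3]
    rw [Real.log_mul (left_ne_zero_of_mul h4) (right_ne_zero_of_mul h4), add_sub_cancel_right,
      ← h3, llr]

lemma sum_mul_dens_mem {p : ι → ℝ} (hp : p ∈ stdSimplex ℝ ι) {y : Y} (hy : ∀ i, dens ν i y ≤ 1) :
    (∑ i, p i * dens ν i y) ∈ Set.Icc (0 : ℝ) 1 := by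
  refine ⟨Finset.sum_nonneg fun i _ => mul_nonneg (hp.1 i) (dens_nonneg ν i y), ?_⟩
  calc _ ≤ ∑ i, p i * 1 := by
        gcongr with i
        · exact hp.1 i
        · exact hy i
    _ = 1 := by simpa using hp.2

/-- The weight `p i` makes `p i * dens ν i y` at most the mixture density `g`, so the term with `log
g` is controlled by `-g log g`, which is bounded on `[0, 1]`. -/
lemma integrable_dens_mul_log {p : ι → ℝ} (hp : p ∈ stdSimplex ℝ ι) (i : ι) :
    Integrable (fun y => p i * (dens ν i y *
      (Real.log (dens ν i y) - Real.log (∑ i, p i * dens ν i y)))) (domMeasure ν) := by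
  have hm : Measurable fun y => ∑ i, p i * dens ν i y :=
    Finset.measurable_fun_sum _ fun i _ => (measurable_dens ν i).const_mul _
  refine Integrable.of_bound (C := 2) ?_ ?_
  · exact (((measurable_dens ν i).mul ((measurable_dens ν i).log.sub hm.log)).const_mul
      (p i)).aestronglyMeasurable
  · filter_upwards [ae_dens_le_one ν] with y hy
    obtain ⟨hg0, hg1⟩ := sum_mul_dens_mem ν hp hy
    have hpi0 := hp.1 i
    have hpi1 : p i ≤ 1 := by
      rw [← hp.2]
      exact Finset.single_le_sum (fun j _ => hp.1 j) (Finset.mem_univ i)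
    have hle : p i * dens ν i y ≤ ∑ i, p i * dens ν i y :=
      Finset.single_le_sum (f := fun i => p i * dens ν i y)
        (fun j _ => mul_nonneg (hp.1 j) (dens_nonneg ν j y)) (Finset.mem_univ i)
    set g := ∑ i, p i * dens ν i y
    have hf0 := dens_nonneg ν i y
    have a1 := Real.negMulLog_nonneg hf0 (hy i)
    have a2 := Real.negMulLog_le_one_sub_self hf0
    have b1 : 0 ≤ p i * dens ν i y * (-Real.log g) :=
      mul_nonneg (mul_nonneg hpi0 hf0) (neg_nonneg.2 (Real.log_nonpos hg0 hg1))
    have b2 : p i * dens ν i y * (-Real.log g) ≤ Real.negMulLog g := by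
      calc _ ≤ g * (-Real.log g) :=
            mul_le_mul_of_nonneg_right hle (neg_nonneg.2 (Real.log_nonpos hg0 hg1))
        _ = _ := by rw [Real.negMulLog]; ring
    have b3 := Real.negMulLog_le_one_sub_self hg0
    have e : p i * (dens ν i y * (Real.log (dens ν i y) - Real.log g)) =
        p i * dens ν i y * (-Real.log g) - p i * Real.negMulLog (dens ν i y) := by
      rw [Real.negMulLog]; ring
    have c1 : 0 ≤ p i * Real.negMulLog (dens ν i y) := mul_nonneg hpi0 a1
    have c2 : p i * Real.negMulLog (dens ν i y) ≤ 1 * 1 :=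
      mul_le_mul hpi1 (by linarith) a1 zero_le_one
    rw [e, Real.norm_eq_abs, abs_le]
    constructor <;> linarith

lemma klDiv_mix_ne_top {p : ι → ℝ} (hp : p ∈ stdSimplex ℝ ι) {i : ι} (hi : p i ≠ 0) :
    klDiv (ν i) (mix ν p) ≠ ∞ := by
  refine klDiv_ne_top (ac_mix ν hp hi) ?_
  rw [← integrable_rnDeriv_smul_iff (ac_domMeasure ν i)]
  have h := (integrable_dens_mul_log ν hp i).const_mul (p i)⁻¹
  refine h.congr ?_
  filter_upwards [dens_mul_llr ν hp hi] with y hy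
  rw [← hy, inv_mul_cancel_left₀ hi]
  rfl

lemma mul_toReal_klDiv_mix {p : ι → ℝ} (hp : p ∈ stdSimplex ℝ ι) (i : ι) :
    p i * (klDiv (ν i) (mix ν p)).toReal = ∫ y, p i * (dens ν i y *
      (Real.log (dens ν i y) - Real.log (∑ i, p i * dens ν i y))) ∂domMeasure ν := by
  by_cases hi : p i = 0
  · simp [hi]
  have := isProbabilityMeasure_mix ν hp
  rw [toReal_klDiv_of_measure_eq (ac_mix ν hp hi) (by simp), integral_const_mul,
    ← integral_rnDeriv_smul (ac_domMeasure ν i)]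
  congr 1
  exact integral_congr_ae (dens_mul_llr ν hp hi)

/-- Output entropy minus conditional entropy, taken under one integral with densities relative to `∑
i, ν i`. They lie in `[0, 1]` almost everywhere, so the integrand is bounded and dominated
convergence gives continuity in `p`, even where the separate divergences blow up. -/
lemma mutualSum_eq_integral {p : ι → ℝ} (hp : p ∈ stdSimplex ℝ ι) :
    mutualSum ν p = ∫ y, (Real.negMulLog (∑ i, p i * dens ν i y) -
      ∑ i, p i * Real.negMulLog (dens ν i y)) ∂domMeasure ν := by
  simp only [mutualSum, mul_toReal_klDiv_mix ν hp]
  rw [← integral_finsetSum _ fun i _ => integrable_dens_mul_log ν hp i]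
  refine integral_congr_ae (ae_of_all _ fun y => ?_)
  simp only [Real.negMulLog, neg_mul, mul_sub, Finset.sum_sub_distrib, Finset.sum_mul,
    Finset.sum_neg_distrib, mul_neg, sub_neg_eq_add, mul_assoc]
  ring

lemma continuousOn_mutualSum : ContinuousOn (mutualSum ν) (stdSimplex ℝ ι) := by
  refine ContinuousOn.congr ?_ fun p hp => mutualSum_eq_integral ν hp
  have hm : ∀ p : ι → ℝ, Measurable fun y => ∑ i, p i * dens ν i y := fun p =>
    Finset.measurable_fun_sum _ fun i _ => (measurable_dens ν i).const_mul _
  refine MeasureTheory.continuousOn_of_dominated (bound := fun _ => 1) ?_ ?_ (integrable_const _) ?_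
  · intro p _
    refine Measurable.aestronglyMeasurable ?_
    exact (Real.continuous_negMulLog.measurable.comp (hm p)).sub
      (Finset.measurable_fun_sum _ fun i _ =>
        (Real.continuous_negMulLog.measurable.comp (measurable_dens ν i)).const_mul _)
  · intro p hp
    filter_upwards [ae_dens_le_one ν] with y hy
    obtain ⟨hg0, hg1⟩ := sum_mul_dens_mem ν hp hy
    have h1 := Real.negMulLog_nonneg hg0 hg1
    have h2 := Real.negMulLog_le_one_sub_self hg0
    have h3 : 0 ≤ ∑ i, p i * Real.negMulLog (dens ν i y) := Finset.sum_nonneg fun i _ =>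
      mul_nonneg (hp.1 i) (Real.negMulLog_nonneg (dens_nonneg ν i y) (hy i))
    have h4 : ∑ i, p i * Real.negMulLog (dens ν i y) ≤ ∑ i, p i * 1 := by
      gcongr with i
      · exact hp.1 i
      · linarith [Real.negMulLog_le_one_sub_self (dens_nonneg ν i y), dens_nonneg ν i y]
    rw [← Finset.sum_mul, hp.2] at h4
    rw [Real.norm_eq_abs, abs_le]
    constructor <;> linarith
  · refine ae_of_all _ fun y => Continuous.continuousOn ?_
    fun_prop

lemma mutualSum_nonneg {p : ι → ℝ} (hp : p ∈ stdSimplex ℝ ι) : 0 ≤ mutualSum ν p :=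
  Finset.sum_nonneg fun i _ => mul_nonneg (hp.1 i) ENNReal.toReal_nonneg

lemma ofReal_mutualSum {p : ι → ℝ} (hp : p ∈ stdSimplex ℝ ι) :
    ENNReal.ofReal (mutualSum ν p) = ∑ i, ENNReal.ofReal (p i) * klDiv (ν i) (mix ν p) := by
  rw [mutualSum, ENNReal.ofReal_sum_of_nonneg fun i _ =>
    mul_nonneg (hp.1 i) ENNReal.toReal_nonneg]
  refine Finset.sum_congr rfl fun i _ => ?_
  rw [ENNReal.ofReal_mul (hp.1 i)]
  -- At weight zero the divergence may be infinite; the convention `0 * ∞ = 0` matches `toReal ∞`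
  -- times zero.
  by_cases hi : p i = 0
  · simp [hi]
  · rw [ENNReal.ofReal_toReal (klDiv_mix_ne_top ν hp hi)]

end FiniteMixtures

/-! ### Compactness of convex hulls. -/

section ConvexHull

open Module in
/-- In finite dimension, the convex hull of a compact set is compact. -/
lemma isCompact_convexHull {E : Type*} [NormedAddCommGroup E] [NormedSpace ℝ E]
    [FiniteDimensional ℝ E] {s : Set E} (hs : IsCompact s) : IsCompact (convexHull ℝ s) := by
  -- Carathéodory: at most `finrank + 1` points are needed, so the hull is a finite union of
  -- continuous images of compact sets.
  have h : convexHull ℝ s = ⋃ N ∈ Finset.range (finrank ℝ E + 2),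
      (fun q : (Fin N → ℝ) × (Fin N → E) => ∑ i, q.1 i • q.2 i) ''
        (stdSimplex ℝ (Fin N) ×ˢ Set.univ.pi fun _ => s) := by
    ext x
    simp only [Set.mem_iUnion, Set.mem_image, Set.mem_prod, Set.mem_univ_pi, Prod.exists,
      Finset.mem_range, exists_prop]
    constructor
    · intro hx
      obtain ⟨ι, _, z, w, hz, hind, hw, hw1, rfl⟩ := eq_pos_convex_span_of_mem_convexHull hx
      let e := Fintype.equivFin ι
      have hcard := hind.card_le_finrank_succ
      have hfr := Submodule.finrank_le (vectorSpan ℝ (Set.range z))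
      refine ⟨Fintype.card ι, by omega, w ∘ e.symm, z ∘ e.symm, ⟨⟨fun i => (hw _).le, ?_⟩,
        fun i => hz ⟨_, rfl⟩⟩, ?_⟩
      · rw [← hw1]
        exact Equiv.sum_comp e.symm w
      · exact Equiv.sum_comp e.symm fun i => w i • z i
    · rintro ⟨N, -, w, z, ⟨hw, hz⟩, rfl⟩
      exact (convex_convexHull ℝ s).sum_mem (fun i _ => hw.1 i) hw.2
        fun i _ => subset_convexHull ℝ s (hz i)
  rw [h]
  refine Finset.isCompact_biUnion _ fun N _ => IsCompact.image ?_ (by fun_prop)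
  exact (isCompact_stdSimplex ℝ (Fin N)).prod (isCompact_univ_pi fun _ => hs)

end ConvexHull

end

noncomputable section

/-! ### Finite input alphabets: probability vectors and closedness of the outer region. -/

section FiniteLaws

variable {α Y : Type*} [Fintype α] [MeasurableSpace α] [MeasurableSingletonClass α]
  [MeasurableSpace Y]

/-- The probability vector of a measure on a finite type. -/
def probVec (μ : Measure α) (x : α) : ℝ := μ.real {x}

lemma probVec_mem (μ : Measure α) [IsProbabilityMeasure μ] : probVec μ ∈ stdSimplex ℝ α := by
  refine ⟨fun x => measureReal_nonneg, ?_⟩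
  have h := sum_measureReal_singleton (μ := μ) Finset.univ
  rw [Finset.coe_univ, probReal_univ] at h
  exact h

lemma lintegral_eq_sum_probVec (μ : Measure α) [IsFiniteMeasure μ] (f : α → ℝ≥0∞) :
    ∫⁻ x, f x ∂μ = ∑ x, ENNReal.ofReal (probVec μ x) * f x := by
  rw [lintegral_fintype]
  refine Finset.sum_congr rfl fun x _ => ?_
  rw [probVec, ofReal_measureReal, mul_comm]

lemma bind_eq_mix (κ : Kernel α Y) (μ : Measure α) [IsFiniteMeasure μ] :
    κ ∘ₘ μ = mix (fun x => κ x) (probVec μ) := by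
  ext s hs
  rw [Measure.bind_apply hs κ.aemeasurable, lintegral_eq_sum_probVec]
  simp [mix, Measure.coe_finsetSum]

/-- The probability measure with a given probability vector. -/
def ofProbVec {a : α → ℝ} (ha : a ∈ stdSimplex ℝ α) : ProbabilityMeasure α :=
  ⟨∑ x, ENNReal.ofReal (a x) • Measure.dirac x,
    isProbabilityMeasure_mix (fun x => Measure.dirac x) ha⟩

lemma probVec_ofProbVec {a : α → ℝ} (ha : a ∈ stdSimplex ℝ α) :
    probVec (ofProbVec ha : Measure α) = a := by
  classical
  funext x
  change (∑ x', ENNReal.ofReal (a x') • Measure.dirac x').real {x} = a x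
  rw [measureReal_def, Measure.coe_finsetSum, Finset.sum_apply, Finset.sum_eq_single x]
  · simp [ha.1 x]
  · intro x' _ hx
    simp [hx]
  · simp

end FiniteLaws

variable {k : ℕ} {X : Fin k → Type u} {Y : Type v} [∀ j, Fintype (X j)]

/-- The probability vector of a vector with independent coordinates. -/
def prodVec (a : ∀ j, X j → ℝ) (x : ∀ j, X j) : ℝ := ∏ j, a j (x j)

lemma prodVec_mem {a : ∀ j, X j → ℝ} (ha : ∀ j, a j ∈ stdSimplex ℝ (X j)) :
    prodVec a ∈ stdSimplex ℝ (∀ j, X j) := by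
  refine ⟨fun x => Finset.prod_nonneg fun j _ => (ha j).1 _, ?_⟩
  simp only [prodVec]
  rw [← Fintype.prod_sum]
  exact Finset.prod_eq_one fun j _ => (ha j).2

lemma continuous_prodVec : Continuous (prodVec (X := X)) := by
  refine continuous_pi fun x => ?_
  unfold prodVec
  fun_prop

variable [∀ j, MeasurableSpace (X j)] [MeasurableSpace Y]
  (W : Kernel (∀ j, X j) Y) [IsMarkovKernel W]

/-- The conditional mutual information (in nats) of an input with law `q`, a product law. -/
def condSum (S : Finset (Fin k)) (q : (∀ j, X j) → ℝ) : ℝ :=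
  ∑ x, q x * mutualSum (fun x' => W (S.piecewise x' x)) q

lemma continuousOn_condSum (S : Finset (Fin k)) :
    ContinuousOn (condSum W S) (stdSimplex ℝ (∀ j, X j)) := by
  unfold condSum
  refine continuousOn_finsetSum _ fun x _ => ?_
  exact (continuous_apply x).continuousOn.mul (continuousOn_mutualSum _)

lemma condSum_nonneg (S : Finset (Fin k)) {q : (∀ j, X j) → ℝ}
    (hq : q ∈ stdSimplex ℝ (∀ j, X j)) : 0 ≤ condSum W S q :=
  Finset.sum_nonneg fun x _ => mul_nonneg (hq.1 x) (mutualSum_nonneg _ hq)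

variable [∀ j, StandardBorelSpace (X j)] [∀ j, Nonempty (X j)] [StandardBorelSpace Y] [Nonempty Y]

namespace IndInput

variable {m : ℕ} (p : IndInput X m)

/-- The probability vector of the input given `U₀ = u`. -/
abbrev condVec (u : Fin m) : (∀ j, X j) → ℝ := prodVec fun j => probVec (p.pX u j : Measure (X j))

/-- The probability vector of `U₀`. -/
abbrev weight : Fin m → ℝ := probVec (p.pU : Measure (Fin m))

lemma condVec_mem (u : Fin m) : p.condVec u ∈ stdSimplex ℝ (∀ j, X j) :=
  prodVec_mem fun _ => probVec_mem _

lemma probVec_inputKernel (u : Fin m) : probVec (p.inputKernel u) = p.condVec u := by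
  funext x
  change (Measure.pi fun j => (p.pX u j : Measure (X j))).real {x} = _
  rw [measureReal_def, ← Set.univ_pi_singleton, Measure.pi_pi, ENNReal.toReal_prod]
  rfl

lemma lintegral_inputMeasure_eq_sum {f : Fin m × (∀ j, X j) → ℝ≥0∞} :
    ∫⁻ z, f z ∂p.inputMeasure = ∑ u, ENNReal.ofReal (p.weight u) *
      ∑ x, ENNReal.ofReal (p.condVec u x) * f (u, x) := by
  rw [lintegral_inputMeasure p (measurable_of_finite f), lintegral_eq_sum_probVec]
  simp only [lintegral_eq_sum_probVec, probVec_inputKernel]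

/-- The probability vector of the input. -/
abbrev inputVec : (∀ j, X j) → ℝ := ∑ u, p.weight u • p.condVec u

lemma inputVec_apply (x : ∀ j, X j) : p.inputVec x = ∑ u, p.weight u * p.condVec u x := by
  rw [inputVec, Finset.sum_apply]
  rfl

lemma inputVec_mem : p.inputVec ∈ stdSimplex ℝ (∀ j, X j) :=
  (convex_stdSimplex ℝ _).sum_mem (fun u _ => (probVec_mem _).1 u)
    (probVec_mem (p.pU : Measure (Fin m))).2 fun u _ => p.condVec_mem u

lemma lintegral_inputMeasure_snd {f : (∀ j, X j) → ℝ≥0∞} :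
    ∫⁻ z, f z.2 ∂p.inputMeasure = ∑ x, ENNReal.ofReal (p.inputVec x) * f x := by
  rw [lintegral_inputMeasure_eq_sum]
  simp only [Finset.mul_sum]
  rw [Finset.sum_comm]
  refine Finset.sum_congr rfl fun x _ => ?_
  rw [inputVec_apply, ENNReal.ofReal_sum_of_nonneg fun u _ =>
    mul_nonneg ((probVec_mem _).1 u) ((p.condVec_mem u).1 x), Finset.sum_mul]
  refine Finset.sum_congr rfl fun u _ => ?_
  rw [ENNReal.ofReal_mul ((probVec_mem _).1 u), mul_assoc]

lemma probVec_inputLaw : probVec p.inputLaw = p.inputVec := by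
  classical
  funext x
  rw [probVec, measureReal_def, ← lintegral_indicator_one (measurableSet_singleton x), inputLaw,
    lintegral_map (measurable_of_finite _) measurable_snd, lintegral_inputMeasure_snd,
    Finset.sum_eq_single x]
  · rw [Set.indicator_of_mem (Set.mem_singleton x), Pi.one_apply, mul_one,
      ENNReal.toReal_ofReal (p.inputVec_mem.1 x)]
  · intro x' _ hx
    simp [hx]
  · simp

lemma outKernel_eq_mix (S : Finset (Fin k)) (u : Fin m) (x : ∀ j, X j) :
    p.outKernel W S (u, x) = mix (fun x' => W (S.piecewise x' x)) (p.condVec u) := by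
  have hpw : Measurable fun x' : ∀ j, X j => S.piecewise x' x := measurable_of_finite _
  rw [outKernel_apply, ← probVec_inputKernel]
  ext s hs
  rw [Measure.bind_apply hs W.aemeasurable, lintegral_map (W.measurable_coe hs) hpw,
    lintegral_eq_sum_probVec]
  simp [mix, Measure.coe_finsetSum]

lemma condInfo_eq_condSum (S : Finset (Fin k)) :
    p.condInfo W S =
      ENNReal.ofReal ((∑ u, p.weight u * condSum W S (p.condVec u)) / Real.log 2) := by
  rw [condInfo_eq, ENNReal.ofReal_div_of_pos (Real.log_pos one_lt_two)]
  congr 1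
  -- Resampling exposes, for each fixed `x`, the mutual information of the channel `x' ↦ W
  -- (S.piecewise x' x)`; the reference law is unaffected because it ignores the coordinates in `S`.
  rw [← lintegral_inputMeasure_resample p S (p.measurable_klDiv_outKernel W S),
    lintegral_inputMeasure_eq_sum, ENNReal.ofReal_sum_of_nonneg fun u _ =>
      mul_nonneg ((probVec_mem _).1 u) (condSum_nonneg W S (p.condVec_mem u))]
  refine Finset.sum_congr rfl fun u _ => ?_
  rw [ENNReal.ofReal_mul ((probVec_mem _).1 u)]
  congr 1
  rw [condSum, ENNReal.ofReal_sum_of_nonneg fun x _ =>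
    mul_nonneg ((p.condVec_mem u).1 x) (mutualSum_nonneg _ (p.condVec_mem u))]
  refine Finset.sum_congr rfl fun x _ => ?_
  rw [ENNReal.ofReal_mul ((p.condVec_mem u).1 x), ofReal_mutualSum _ (p.condVec_mem u),
    lintegral_eq_sum_probVec, probVec_inputKernel]
  simp only [outKernel_eq_mix, Finset.piecewise_idem_right]

lemma info_eq_mutualSum :
    p.info W = ENNReal.ofReal (mutualSum (fun x => W x) p.inputVec / Real.log 2) := by
  rw [info_eq, ENNReal.ofReal_div_of_pos (Real.log_pos one_lt_two)]
  congr 1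
  rw [lintegral_inputMeasure_snd p (f := fun x => klDiv (W x) (W ∘ₘ p.inputLaw)),
    ofReal_mutualSum _ p.inputVec_mem, bind_eq_mix, probVec_inputLaw]

lemma satisfiesCost_iff (b : ∀ j, X j → ℝ≥0) (B : Fin k → ℝ≥0) :
    p.SatisfiesCost b B ↔ ∀ j, ∑ x, p.inputVec x * b j (x j) ≤ B j := by
  refine forall_congr' fun j => ?_
  change ∫⁻ z, (b j (z.2 j) : ℝ≥0∞) ∂p.inputMeasure ≤ B j ↔ _
  have h : ∑ x, ENNReal.ofReal (p.inputVec x) * (b j (x j) : ℝ≥0∞) =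
      ENNReal.ofReal (∑ x, p.inputVec x * b j (x j)) := by
    rw [ENNReal.ofReal_sum_of_nonneg fun x _ =>
      mul_nonneg (p.inputVec_mem.1 x) (b j (x j)).coe_nonneg]
    simp only [ENNReal.ofReal_mul (p.inputVec_mem.1 _), ENNReal.ofReal_coe_nnreal]
  rw [lintegral_inputMeasure_snd p (f := fun x => (b j (x j) : ℝ≥0∞)), h,
    ← ENNReal.ofReal_coe_nnreal (p := B j), ENNReal.ofReal_le_ofReal_iff (B j).coe_nonneg]

end IndInput

/-- The input law and all the conditional mutual informations (in nats) of a product input. -/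
def infoPoint (a : ∀ j, X j → ℝ) : ((∀ j, X j) → ℝ) × (Finset (Fin k) → ℝ) :=
  (prodVec a, fun S => condSum W S (prodVec a))

/-- The convex hull of the information points of product inputs. -/
def infoHull : Set (((∀ j, X j) → ℝ) × (Finset (Fin k) → ℝ)) :=
  convexHull ℝ (infoPoint W '' Set.univ.pi fun j => stdSimplex ℝ (X j))

/-- Plays the role of a cardinality bound on U₀ in the passage to the limit. -/
lemma isCompact_infoHull : IsCompact (infoHull W) := by
  refine isCompact_convexHull (IsCompact.image_of_continuousOn
    (isCompact_univ_pi fun j => isCompact_stdSimplex ℝ (X j)) ?_)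
  have hmaps : Set.MapsTo (prodVec (X := X)) (Set.univ.pi fun j => stdSimplex ℝ (X j))
      (stdSimplex ℝ (∀ j, X j)) := fun a ha => prodVec_mem fun j => ha j trivial
  exact continuous_prodVec.continuousOn.prodMk (continuousOn_pi.2 fun S =>
    (continuousOn_condSum W S).comp continuous_prodVec.continuousOn hmaps)

lemma fst_mem_of_mem_infoHull {z : ((∀ j, X j) → ℝ) × (Finset (Fin k) → ℝ)}
    (hz : z ∈ infoHull W) : z.1 ∈ stdSimplex ℝ (∀ j, X j) := by
  have hsub : infoHull W ⊆ Prod.fst ⁻¹' stdSimplex ℝ (∀ j, X j) := by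
    refine convexHull_min ?_ ((convex_stdSimplex ℝ _).linear_preimage (LinearMap.fst ℝ _ _))
    rintro _ ⟨a, ha, rfl⟩
    exact prodVec_mem fun j => ha j trivial
  exact hsub hz

/-- The information point of an input distribution. -/
def IndInput.point {m : ℕ} (p : IndInput X m) : ((∀ j, X j) → ℝ) × (Finset (Fin k) → ℝ) :=
  (p.inputVec, fun S => ∑ u, p.weight u * condSum W S (p.condVec u))

lemma IndInput.point_mem {m : ℕ} (p : IndInput X m) : p.point W ∈ infoHull W := by
  have h : p.point W = ∑ u, p.weight u • infoPoint W fun j =>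
      probVec (p.pX u j : Measure (X j)) := by
    refine Prod.ext ?_ ?_
    · rw [Prod.fst_sum]; rfl
    · rw [Prod.snd_sum]
      funext S
      simp [IndInput.point, infoPoint]
  rw [h]
  exact (convex_convexHull ℝ _).sum_mem (fun u _ => (probVec_mem _).1 u)
    (probVec_mem (p.pU : Measure (Fin m))).2 fun u _ =>
      subset_convexHull ℝ _ ⟨_, fun j _ => probVec_mem _, rfl⟩

/-- The weights of a convex combination serve as the law of U₀ and its points as the conditional
product laws. -/
lemma exists_point_eq {z : ((∀ j, X j) → ℝ) × (Finset (Fin k) → ℝ)} (hz : z ∈ infoHull W) :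
    ∃ (m : ℕ) (p : IndInput X m), p.point W = z := by
  obtain ⟨ι, _, w, a, hw, hw1, ha, rfl⟩ := mem_convexHull_iff_exists_fintype.1 hz
  choose q hq hqa using ha
  let e := Fintype.equivFin ι
  have hwe : w ∘ e.symm ∈ stdSimplex ℝ (Fin (Fintype.card ι)) :=
    ⟨fun _ => hw _, (Equiv.sum_comp e.symm w).trans hw1⟩
  let p : IndInput X (Fintype.card ι) :=
    ⟨ofProbVec hwe, fun u j => ofProbVec (hq (e.symm u) j trivial)⟩
  have hc : ∀ u, p.condVec u = prodVec (q (e.symm u)) := fun u => by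
    rw [IndInput.condVec]
    congr 1
    funext j
    exact probVec_ofProbVec (hq (e.symm u) j trivial)
  have hwt : p.weight = w ∘ e.symm := probVec_ofProbVec hwe
  refine ⟨_, p, ?_⟩
  rw [← Equiv.sum_comp e.symm]
  refine Prod.ext ?_ ?_
  · rw [Prod.fst_sum]
    change ∑ u, p.weight u • p.condVec u = _
    refine Finset.sum_congr rfl fun u _ => ?_
    rw [hc, hwt, ← hqa]
    rfl
  · rw [Prod.snd_sum]
    funext S
    rw [Finset.sum_apply]
    change ∑ u, p.weight u * condSum W S (p.condVec u) = _
    refine Finset.sum_congr rfl fun u _ => ?_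
    rw [hc, hwt, ← hqa]
    rfl

/-- The conditions of the outer region in terms of information points. -/
lemma mem_outerRegion_iff {b : ∀ j, X j → ℝ≥0} {B : Fin k → ℝ≥0} {C : Fin k → Fin k → ℝ≥0}
    {R : Fin k → ℝ} : R ∈ outerRegion W b B C ↔ (∀ j, 0 ≤ R j) ∧ ∃ z ∈ infoHull W,
      (∀ j, ∑ x, z.1 x * b j (x j) ≤ B j) ∧
      (∀ S : Finset (Fin k), S.Nonempty →
        ∑ j ∈ S, R j ≤ z.2 S / Real.log 2 + linkCapacity C S) ∧
      ∑ j, R j ≤ mutualSum (fun x => W x) z.1 / Real.log 2 := by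
  have hl : 0 < Real.log 2 := Real.log_pos one_lt_two
  have key : ∀ {m : ℕ} (p : IndInput X m), (p.SatisfiesCost b B ∧
      (∀ S : Finset (Fin k), S.Nonempty → ENNReal.ofReal (∑ j ∈ S, R j) ≤
        p.condInfo W S + ∑ j ∈ S, ∑ i ∈ Finset.univ.erase j, (C j i : ℝ≥0∞)) ∧
      ENNReal.ofReal (∑ j, R j) ≤ p.info W) ↔ ((∀ j, ∑ x, (p.point W).1 x * b j (x j) ≤ B j) ∧
      (∀ S : Finset (Fin k), S.Nonempty →
        ∑ j ∈ S, R j ≤ (p.point W).2 S / Real.log 2 + linkCapacity C S) ∧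
      ∑ j, R j ≤ mutualSum (fun x => W x) (p.point W).1 / Real.log 2) := by
    intro m p
    refine and_congr (p.satisfiesCost_iff b B) (and_congr (forall_congr' fun S =>
      imp_congr Iff.rfl ?_) ?_)
    · have hC : (∑ j ∈ S, ∑ i ∈ Finset.univ.erase j, (C j i : ℝ≥0∞)) =
          ENNReal.ofReal (linkCapacity C S) := by
        rw [ENNReal.ofReal_coe_nnreal]
        push_cast
        rfl
      change _ ↔ _ ≤ (∑ u, p.weight u * condSum W S (p.condVec u)) / Real.log 2 + _
      have h0 : 0 ≤ (∑ u, p.weight u * condSum W S (p.condVec u)) / Real.log 2 :=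
        div_nonneg (Finset.sum_nonneg fun u _ => mul_nonneg ((probVec_mem _).1 u)
          (condSum_nonneg W S (p.condVec_mem u))) hl.le
      rw [hC, p.condInfo_eq_condSum W S, ← ENNReal.ofReal_add h0 (NNReal.coe_nonneg _)]
      exact ENNReal.ofReal_le_ofReal_iff (add_nonneg h0 (NNReal.coe_nonneg _))
    · rw [p.info_eq_mutualSum W]
      exact ENNReal.ofReal_le_ofReal_iff (div_nonneg (mutualSum_nonneg _ p.inputVec_mem) hl.le)
  constructor
  · rintro ⟨h0, m, p, h⟩
    exact ⟨h0, p.point W, p.point_mem W, (key p).1 h⟩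
  · rintro ⟨h0, z, hz, h⟩
    obtain ⟨m, p, rfl⟩ := exists_point_eq W hz
    exact ⟨h0, m, p, (key p).2 h⟩

/-- For finite input alphabets the outer region is closed. -/
lemma isClosed_outerRegion (b : ∀ j, X j → ℝ≥0) (B : Fin k → ℝ≥0) (C : Fin k → Fin k → ℝ≥0) :
    IsClosed (outerRegion W b B C) := by
  refine IsSeqClosed.isClosed fun R R' hR hlim => ?_
  simp only [mem_outerRegion_iff] at hR
  choose h0 z hz hcost hS htot using hR
  -- The sizes of the alphabets of U₀ may be unbounded along the sequence, so the limit is taken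
  -- among information points, not among input distributions.
  obtain ⟨z', hz', φ, hφ, hzlim⟩ := (isCompact_infoHull W).tendsto_subseq hz
  have hRlim : Tendsto (R ∘ φ) atTop (𝓝 R') := hlim.comp hφ.tendsto_atTop
  have hRj : ∀ j, Tendsto (fun n => R (φ n) j) atTop (𝓝 (R' j)) := tendsto_pi_nhds.1 hRlim
  have hz1 : Tendsto (fun n => (z (φ n)).1) atTop (𝓝 z'.1) :=
    (continuous_fst.tendsto _).comp hzlim
  have hz2 : Tendsto (fun n => (z (φ n)).2) atTop (𝓝 z'.2) :=
    (continuous_snd.tendsto _).comp hzlim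
  refine (mem_outerRegion_iff W).2 ⟨fun j => ge_of_tendsto' (hRj j) fun n => h0 _ j, z', hz',
    fun j => ?_, fun S hSne => ?_, ?_⟩
  · exact le_of_tendsto' (tendsto_finsetSum _ fun x _ =>
      ((tendsto_pi_nhds.1 hz1 x).mul_const _)) fun n => hcost (φ n) j
  · exact le_of_tendsto_of_tendsto' (tendsto_finsetSum _ fun j _ => hRj j)
      (((tendsto_pi_nhds.1 hz2 S).div_const _).add_const _) fun n => hS (φ n) S hSne
  -- Continuity is available only on the simplex, so convergence is taken within it.
  · have hm : Tendsto (fun n => mutualSum (fun x => W x) (z (φ n)).1) atTop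
        (𝓝 (mutualSum (fun x => W x) z'.1)) :=
      (continuousOn_mutualSum (fun x => W x) z'.1 (fst_mem_of_mem_infoHull W hz')).tendsto.comp
        (tendsto_nhdsWithin_iff.2 ⟨hz1, Eventually.of_forall fun n =>
          fst_mem_of_mem_infoHull W (hz (φ n))⟩)
    exact le_of_tendsto_of_tendsto' (tendsto_finsetSum _ fun j _ => hRj j) (hm.div_const _)
      fun n => htot (φ n)

end

end ConferencingMAC

theorem mainTheorem8 {k : ℕ} {X : Fin k → Type*} {Y : Type*}
    [∀ j, MeasurableSpace (X j)] [∀ j, StandardBorelSpace (X j)] [∀ j, Nonempty (X j)]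
    [MeasurableSpace Y] [StandardBorelSpace Y] [Nonempty Y]
    (W : Kernel (∀ j, X j) Y) [IsMarkovKernel W]
    (b : ∀ j, X j → ℝ≥0) (hb : ∀ j, Measurable (b j)) (B : Fin k → ℝ≥0)
    (C : Fin k → Fin k → ℝ≥0) (Λ : Set ℕ) :
    ConferencingMAC.capacityRegion W b B C Λ ⊆
        closure (ConferencingMAC.outerRegion W b B C) ∧
      ((∀ j, Finite (X j)) →
        ConferencingMAC.capacityRegion W b B C Λ ⊆ ConferencingMAC.outerRegion W b B C) := by
  refine ⟨ConferencingMAC.capacityRegion_subset_closure W hb Λ, fun hfin => ?_⟩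
  have := fun j => Fintype.ofFinite (X j)
  have h := ConferencingMAC.capacityRegion_subset_closure W hb (B := B) (C := C) Λ
  rwa [(ConferencingMAC.isClosed_outerRegion W b B C).closure_eq] at h
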